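/- For a bounded operator $T$ on a complex Hilbert space let $M_{pb}(T)\in[0,\infty]$ be the smallest $M$ with $\|p(T)\|\le M\sup_{z\in\mathbb D}|p(z)|$ for all polynomials $p$, and let $M_{cpb}(T)\in[0,\infty]$ be the smallest $M$ with $\|[p_{ij}(T)]_{i,j=1}^n\|\le M\sup_{z\in\mathbb D}\|[p_{ij}(z)]_{i,j=1}^n\|_{\mathcal L(\ell^2_n)}$ for all $n$ and all $n\times n$ families of polynomials (each is $\infty$ if no finite constant works). For a finite Blaschke product $B$ let $\mathcal K_B=H^2\ominus BH^2$ and $T_B=P_{\mathcal K_B}S|_{\mathcal K_B}$, where $S$ is multiplication by $z$ on the Hardy space $H^2$ of the unit disk $\mathbb D$. Write $T\approx R$ if $XT=RX$ for some bounded operator $X$ with bounded inverse. For $N\ge 0$ and $0\le j\le N$ put $V=\begin{pmatrix}1&0\\0&-1\end{pmatrix}$, $C=\begin{pmatrix}0&0\\1&0\end{pmatrix}$ and $C_{Nj}=V^{\otimes j}\otimes C\otimes I_2^{\otimes (N-j)}$, acting on $\mathbb C^{2^{N+1}}$. On $\bigoplus_{n=0}^N\mathbb C^{2^{N+1}}$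 let $S_N$ be the block matrix (with block indices $0,\dots,N$) having identity blocks on the first superdiagonal and zeros elsewhere. For $\alpha_{N0},\dots,\alpha_{NN}\in\mathbb C$ let $\Gamma_N$ be the block matrix whose $(i,k)$ block is $\alpha_{N,2N-i-k}C_{N,2N-i-k}$ if $i+k\ge N$ and $0$ otherwise, and put $$R_N=\begin{pmatrix}S_N^*&\Gamma_N\\ 0&S_N\end{pmatrix}\quad\text{on}\quad \mathcal H_N=\bigoplus_{n=0}^N\mathbb C^{2^{N+1}}\oplus\bigoplus_{n=0}^N\mathbb C^{2^{N+1}}.$$ **Theorem.** There are coefficients $\alpha_{Nj}\in\mathbb C$ ($0\le j\le N$, $N\ge0$) with $$\sup_N\sup_{1\le n\le N+1}n^2\sum_{j=n-1}^N|\alpha_{Nj}|^2<\infty,\qquad \sup_N\sum_{j=1}^{N+1}j^2|\alpha_{N,j-1}|^2=\infty$$ such that for every sequence $\varepsilon_N>0$ there are diagonal $2^{N+1}\times2^{N+1}$ matrices $D_{N\star}$, $D_N$ with diagonal entries in $(0,\varepsilon_N)$, and finite Blaschke products $B_N$ with all zeros in $(0,1)$, for which the operators $$T_N=R_N+\bigoplus_{n=0}^N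 D_{N\star}\oplus\bigoplus_{n=0}^N D_N$$ on the finite-dimensional Hilbert spaces $\mathcal H_N$ satisfy $T_N\approx T_{B_N}$ for every $N$, $\ \sup_N M_{pb}(T_N)<\infty\ $ and $\ \sup_N M_{cpb}(T_N)=\infty$. -/

import Mathlib

open scoped ENNReal

noncomputable section

/-! ### Polynomial bound and complete polynomial bound -/

section Bounds

variable {H : Type*} [NormedAddCommGroup H] [InnerProductSpace ℂ H]

/-- `‖p‖_∞`, the supremum of `|p|` over the open unit disk. -/
def polySupNorm (p : Polynomial ℂ) : ℝ≥0∞ :=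
  ⨆ z ∈ Metric.ball (0 : ℂ) 1, ‖p.eval z‖ₑ

/-- `M_pb(T)`: the smallest `M` with `‖p(T)‖ ≤ M ‖p‖_∞` for all polynomials `p`,
and `∞` if there is no finite such `M`. -/
def Mpb (T : H →L[ℂ] H) : ℝ≥0∞ :=
  sInf {M | ∀ p : Polynomial ℂ, ‖Polynomial.aeval T p‖ₑ ≤ M * polySupNorm p}

/-- The supremum over the open unit disk of the operator norm on `ℓ²_n` of `[p_ij(z)]`. -/
def matPolySupNorm {n : ℕ} (p : Matrix (Fin n) (Fin n) (Polynomial ℂ)) : ℝ≥0∞ :=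
  ⨆ z ∈ Metric.ball (0 : ℂ) 1,
    ‖Matrix.toEuclideanCLM (n := Fin n) (𝕜 := ℂ) (p.map (Polynomial.eval z))‖ₑ

/-- The operator on the Hilbert sum of `n` copies of `H` with operator matrix `A`. -/
def blockOperator {n : ℕ} (A : Matrix (Fin n) (Fin n) (H →L[ℂ] H)) :
    PiLp 2 (fun _ : Fin n => H) →L[ℂ] PiLp 2 (fun _ : Fin n => H) :=
  ((PiLp.continuousLinearEquiv 2 ℂ (fun _ : Fin n => H)).symm :
      (Fin n → H) →L[ℂ] PiLp 2 (fun _ : Fin n => H)) ∘L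
    (ContinuousLinearMap.pi fun i => ∑ j, A i j ∘L PiLp.proj 2 (fun _ : Fin n => H) j)

/-- `M_cpb(T)`: the smallest `M` with `‖[p_ij(T)]‖ ≤ M ‖[p_ij]‖` for all square matrices
of polynomials, and `∞` if there is no finite such `M`. -/
def Mcpb (T : H →L[ℂ] H) : ℝ≥0∞ :=
  sInf {M | ∀ (n : ℕ) (p : Matrix (Fin n) (Fin n) (Polynomial ℂ)),
    ‖blockOperator (p.map (Polynomial.aeval T))‖ₑ ≤ M * matPolySupNorm p}

/-- Similarity of operators: they are intertwined by a bounded operator with bounded inverse. -/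
def SimilarOp {K : Type*} [NormedAddCommGroup K] [InnerProductSpace ℂ K]
    (T : H →L[ℂ] H) (R : K →L[ℂ] K) : Prop :=
  ∃ X : H ≃L[ℂ] K, ∀ x, X (T x) = R (X x)

end Bounds

/-! ### The Hardy space `H²`, model spaces and model operators -/

/-- The Hardy space `H²` of the disk; an element is given by its (square-summable) Taylor
coefficients. -/
abbrev HardyTwo : Type := lp (fun _ : ℕ => ℂ) 2

/-- The value at `z` of the analytic function with Taylor coefficients `f`. -/
def HardyTwo.eval (f : HardyTwo) (z : ℂ) : ℂ := ∑' n, f n * z ^ n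

/-- The coefficients of `z ↦ z f(z)`. -/
def shiftSeq (f : ℕ → ℂ) : ℕ → ℂ
  | 0 => 0
  | n + 1 => f n

theorem HardyTwo.summable_sq (f : HardyTwo) : Summable fun n => ‖f n‖ ^ 2 := by
  have h := (lp.hasSum_norm (by norm_num) f).summable
  simpa using h

theorem hasSum_shiftSeq (f : HardyTwo) :
    HasSum (fun n => ‖shiftSeq f n‖ ^ 2) (∑' n, ‖f n‖ ^ 2) := by
  rw [← hasSum_nat_add_iff' 1]
  simpa [shiftSeq] using f.summable_sq.hasSum

theorem memlp_shiftSeq (f : HardyTwo) : Memℓp (shiftSeq f) 2 :=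
  memℓp_gen (by simpa using (hasSum_shiftSeq f).summable)

/-- The unilateral shift `S` on `H²`, multiplication by the independent variable. -/
def hardyShift : HardyTwo →L[ℂ] HardyTwo :=
  LinearMap.mkContinuous
    { toFun := fun f => ⟨shiftSeq f, memlp_shiftSeq f⟩
      map_add' := fun f g => by
        ext n
        cases n with
        | zero => exact (add_zero (0 : ℂ)).symm
        | succ n => rfl
      map_smul' := fun c f => by
        ext n; cases n <;> simp [shiftSeq] } 1 (fun f => by
      refine lp.norm_le_of_tsum_le (by norm_num) (by positivity) ?_
      have h := lp.norm_rpow_eq_tsum (p := 2) (by norm_num) f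
      simp only [one_mul, h]
      simpa using (hasSum_shiftSeq f).tsum_eq.le)

theorem HardyTwo.summable_eval (f : HardyTwo) {z : ℂ} (hz : ‖z‖ < 1) :
    Summable fun n => f n * z ^ n := by
  have hg : Summable fun n : ℕ => ‖f‖ * ‖z‖ ^ n :=
    (summable_geometric_of_lt_one (norm_nonneg z) hz).mul_left _
  refine Summable.of_norm_bounded hg fun n => ?_
  rw [norm_mul, norm_pow]
  exact mul_le_mul_of_nonneg_right (lp.norm_apply_le_norm (by norm_num) f n) (by positivity)

/-- `θ H²`: the functions in `H²` of the form `θ g` with `g ∈ H²`. -/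
def mulHardy (θ : ℂ → ℂ) : Submodule ℂ HardyTwo where
  carrier := {f | ∃ g : HardyTwo, ∀ z ∈ Metric.ball (0 : ℂ) 1, f.eval z = θ z * g.eval z}
  zero_mem' := ⟨0, fun z _ => by simp [HardyTwo.eval]⟩
  add_mem' := by
    rintro a b ⟨g, hg⟩ ⟨h, hh⟩
    refine ⟨g + h, fun z hz => ?_⟩
    have hz' : ‖z‖ < 1 := by simpa using hz
    have key : ∀ u v : HardyTwo, (u + v).eval z = u.eval z + v.eval z := fun u v => by
      simp only [HardyTwo.eval]
      rw [← (u.summable_eval hz').tsum_add (v.summable_eval hz')]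
      simp [add_mul]
    rw [key, key, hg z hz, hh z hz, mul_add]
  smul_mem' := by
    rintro c a ⟨g, hg⟩
    refine ⟨c • g, fun z hz => ?_⟩
    have key : ∀ u : HardyTwo, (c • u).eval z = c * u.eval z := fun u => by
      simp only [HardyTwo.eval]
      rw [← tsum_mul_left]
      simp [mul_assoc]
    rw [key, key, hg z hz]
    ring

/-- The model space `K_θ = H² ⊖ θ H²`. -/
abbrev modelSpace (θ : ℂ → ℂ) : Submodule ℂ HardyTwo := (mulHardy θ)ᗮ

/-- The model operator `T_θ = P_{K_θ} S |_{K_θ}`. -/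
def modelOperator (θ : ℂ → ℂ) : modelSpace θ →L[ℂ] modelSpace θ :=
  (modelSpace θ).orthogonalProjectionOnto ∘L hardyShift ∘L (modelSpace θ).subtypeL

/-- The Blaschke factor with zero at `a`. -/
def blaschkeFactor (a z : ℂ) : ℂ :=
  if a = 0 then z else (‖a‖ : ℂ) / a * ((a - z) / (1 - starRingEnd ℂ a * z))

/-- `B` is, on the unit disk, a finite Blaschke product with zeros `s`, listed with
multiplicity. -/
def IsFiniteBlaschkeProduct (B : ℂ → ℂ) (s : Multiset ℂ) : Prop :=
  (∀ a ∈ s, ‖a‖ < 1) ∧ ∃ ζ : ℂ, ‖ζ‖ = 1 ∧ ∀ z ∈ Metric.ball (0 : ℂ) 1,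
    B z = ζ * (s.map fun a => blaschkeFactor a z).prod

/-! ### Truncated Foguel–Hankel matrices -/

section FoguelHankel

variable {ι : Type*} [DecidableEq ι]

/-- The tensor product `M 0 ⊗ ⋯ ⊗ M (m - 1)` of `2 × 2` matrices, in the product basis
of `ℂ² ⊗ ⋯ ⊗ ℂ²`. -/
def tensorMatrix {m : ℕ} (M : Fin m → Matrix (Fin 2) (Fin 2) ℂ) :
    Matrix (Fin m → Fin 2) (Fin m → Fin 2) ℂ :=
  Matrix.of fun x y => ∏ l, M l (x l) (y l)

/-- `C_{Nj} = V^{⊗ j} ⊗ C ⊗ I₂^{⊗ (N - j)}` for `0 ≤ j ≤ N`. -/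
def carMatrix (N j : ℕ) : Matrix (Fin (N + 1) → Fin 2) (Fin (N + 1) → Fin 2) ℂ :=
  tensorMatrix fun l : Fin (N + 1) =>
    if (l : ℕ) < j then !![1, 0; 0, -1] else if (l : ℕ) = j then !![0, 0; 1, 0] else 1

/-- The truncated block shift on the sum of `N + 1` copies of `ℂ^ι`: identity blocks on the
first superdiagonal. -/
def truncShift (ι : Type*) [DecidableEq ι] (N : ℕ) :
    Matrix (Fin (N + 1) × ι) (Fin (N + 1) × ι) ℂ :=
  Matrix.of fun x y => if (x.1 : ℕ) + 1 = y.1 ∧ x.2 = y.2 then 1 else 0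

/-- The block Hankel matrix whose last row is `A_N, …, A_1, A_0`, whose last column is
`A_N, …, A_1, A_0` from top to bottom, and which vanishes above the antidiagonal. -/
def hankelMatrix (N : ℕ) (A : ℕ → Matrix ι ι ℂ) :
    Matrix (Fin (N + 1) × ι) (Fin (N + 1) × ι) ℂ :=
  Matrix.of fun x y =>
    if N ≤ (x.1 : ℕ) + y.1 then A (2 * N - ((x.1 : ℕ) + y.1)) x.2 y.2 else 0

/-- The truncated Foguel–Hankel matrix `Q_N(A_0, …, A_N) = [S* Γ; 0 S]`. -/
def truncFoguelHankel (N : ℕ) (A : ℕ → Matrix ι ι ℂ) :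
    Matrix ((Fin (N + 1) × ι) ⊕ (Fin (N + 1) × ι)) ((Fin (N + 1) × ι) ⊕ (Fin (N + 1) × ι)) ℂ :=
  Matrix.fromBlocks (truncShift ι N).conjTranspose (hankelMatrix N A) 0 (truncShift ι N)

/-- The diagonal matrix `(⊕_{n=0}^N diag ν) ⊕ (⊕_{n=0}^N diag μ)`. -/
def diagPerturbation (N : ℕ) (ν μ : ι → ℝ) :
    Matrix ((Fin (N + 1) × ι) ⊕ (Fin (N + 1) × ι)) ((Fin (N + 1) × ι) ⊕ (Fin (N + 1) × ι)) ℂ :=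
  Matrix.diagonal (Sum.elim (fun x => (ν x.2 : ℂ)) (fun x => (μ x.2 : ℂ)))

end FoguelHankel

/-- The index set of the standard basis of
`⊕_{j=0}^N ℂ^{2^{N+1}} ⊕ ⊕_{j=0}^N ℂ^{2^{N+1}}`. -/
abbrev FHIndex (N : ℕ) : Type :=
  (Fin (N + 1) × (Fin (N + 1) → Fin 2)) ⊕ (Fin (N + 1) × (Fin (N + 1) → Fin 2))

/-- `R_N(α_0, …, α_N) = Q_N(α_0 C_{N0}, …, α_N C_{NN})`. -/
def pisierMatrix (N : ℕ) (α : ℕ → ℂ) : Matrix (FHIndex N) (FHIndex N) ℂ :=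
  truncFoguelHankel N fun j => α j • carMatrix N j

/-- The condition on the coefficients `α_{Nj}`, `0 ≤ j ≤ N`:
`sup_N sup_{1 ≤ n ≤ N+1} n² ∑_{j=n-1}^N |α_{Nj}|² < ∞` and
`sup_N ∑_{j=1}^{N+1} j² |α_{N,j-1}|² = ∞`. -/
def AdmissibleCoeffs (α : ℕ → ℕ → ℂ) : Prop :=
  (∃ K : ℝ, ∀ N : ℕ, ∀ n ∈ Finset.Icc 1 (N + 1),
    (n : ℝ) ^ 2 * ∑ j ∈ Finset.Icc (n - 1) N, ‖α N j‖ ^ 2 ≤ K) ∧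
  ∀ K : ℝ, ∃ N : ℕ, K < ∑ j ∈ Finset.Icc 1 (N + 1), (j : ℝ) ^ 2 * ‖α N (j - 1)‖ ^ 2

end

/-! Since S*Γ = ΓS, the matrix p(R_N) has diagonal blocks p(S*) and p(S) and corner Γp'(S). The
diagonal blocks are bounded by ‖p‖_∞, so everything depends on the corner.

Polynomial bound. Read vectors as tuples f, h of polynomials. The corner, paired with them, is the
sum over j of α_j times the j-th coefficient of p' w_j, where w_j = ∑ C_{Nj}(x,y) h_x f_y. The
anticommutation relations of the C_{Nj} give ∑_j |w_j|² ≤ |f|²|h|² at each point of the circle.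
Dividing by an outer φ with |φ| = |f| yields w_j = φω_j with ∑ ‖ω_j‖² ≤ ‖h‖² in H². Cauchy–Schwarz
then leaves ∑ |α_j|² ∑_{m≤j} |(p'φ)_m|², and p'φ = (pφ)' - pφ' together with the tail condition on α
bounds this by 4‖p‖_∞²‖φ‖². An approximate polynomial outer factor suffices (`exists_approx_outer`,
`norm_sum_coeff_deriv_bilin_le`).

Complete bound. Let s = ∑ (j+1)²|α_j|². The matrix polynomial ∑ (j+1) conj(α_j) z^(j+1) C_{Nj} has
norm at most √s on the disk by the same relations. At R_N its norm is at least s/2, because ∑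
|C_{Nj}(x,y)|² = 2^N. The ratio is of order √s, which is unbounded in N.

Perturbation. R_N is nilpotent, so p(T) is close to p(R_N) for T near R_N, uniformly in p with
bounded coefficients; the lower bound involves finitely many polynomials and survives by continuity.
Distinct small diagonal entries separate the eigenvalues of the Jordan blocks and make T_N cyclic. A
cyclic operator and the model operator with the same characteristic polynomial χ are both
multiplication by X on ℂ[X]/(χ), hence similar (`exists_cyclic_vector`, `similarOp_modelOperator`).
-/

section

open Polynomial Finset Matrix

/-! ### Hardy norms and bounded multipliers on polynomials. -/

/-- The square of the Hardy-space norm of a polynomial. -/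
noncomputable def hardySq (f : ℂ[X]) : ℝ := ∑ i ∈ f.support, ‖f.coeff i‖ ^ 2

theorem hardySq_nonneg (f : ℂ[X]) : 0 ≤ hardySq f :=
  Finset.sum_nonneg fun _ _ => by positivity

theorem sum_sq_coeff_le_hardySq (f : ℂ[X]) (s : Finset ℕ) :
    ∑ i ∈ s, ‖f.coeff i‖ ^ 2 ≤ hardySq f := by
  classical
  rw [hardySq, ← Finset.sum_filter_ne_zero]
  refine Finset.sum_le_sum_of_subset_of_nonneg (fun i hi => ?_) fun _ _ _ => by positivity
  rw [Finset.mem_filter] at hi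
  rw [Polynomial.mem_support_iff]
  intro h
  simp [h] at hi

theorem hardySq_eq_sum_range {f : ℂ[X]} {M : ℕ} (h : ∀ n, M ≤ n → f.coeff n = 0) :
    hardySq f = ∑ i ∈ range M, ‖f.coeff i‖ ^ 2 := by
  refine le_antisymm ?_ (sum_sq_coeff_le_hardySq _ _)
  refine Finset.sum_le_sum_of_subset_of_nonneg (fun i hi => ?_) fun _ _ _ => by positivity
  rw [Polynomial.mem_support_iff] at hi
  rw [Finset.mem_range]
  by_contra hn
  exact hi (h i (not_lt.mp hn))

theorem hardySq_C_mul (c : ℂ) (f : ℂ[X]) : hardySq (C c * f) = ‖c‖ ^ 2 * hardySq f := by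
  have h1 : ∀ n, f.natDegree + 1 ≤ n → f.coeff n = 0 :=
    fun n hn => coeff_eq_zero_of_natDegree_lt hn
  rw [hardySq_eq_sum_range h1, hardySq_eq_sum_range (M := f.natDegree + 1), Finset.mul_sum]
  · simp [mul_pow]
  · intro n hn
    simp [h1 n hn]

theorem circleIntegrable_of_continuous {g : ℂ → ℝ} (hg : Continuous g) :
    CircleIntegrable g 0 1 :=
  hg.continuousOn.circleIntegrable zero_le_one

theorem sum_hardySq_eq_circleAverage {σ : Type*} [Fintype σ] (f : σ → ℂ[X]) :
    ∑ i, hardySq (f i) = Real.circleAverage (fun z => ∑ i, ‖(f i).eval z‖ ^ 2) 0 1 := by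
  rw [Real.circleAverage_fun_sum fun i _ => circleIntegrable_of_continuous (by fun_prop)]
  simp only [hardySq, sum_sq_norm_coeff_eq_circleAverage]

/-- By Parseval `hardySq` is a circle average, so inequalities that hold pointwise on the circle can
be integrated. -/
theorem sum_hardySq_le_of_circle {ι κ : Type*} [Fintype ι] [Fintype κ] {f : ι → ℂ[X]}
    {g : κ → ℂ[X]} {c : ℝ}
    (h : ∀ z : ℂ, ‖z‖ = 1 → ∑ i, ‖(f i).eval z‖ ^ 2 ≤ ∑ k, ‖(g k).eval z‖ ^ 2 + c) :
    ∑ i, hardySq (f i) ≤ ∑ k, hardySq (g k) + c := by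
  have h1 : ∑ k, hardySq (g k) + c =
      Real.circleAverage (fun z => ∑ k, ‖(g k).eval z‖ ^ 2 + c) 0 1 := by
    rw [Real.circleAverage_fun_add (circleIntegrable_of_continuous (by fun_prop))
      (circleIntegrable_of_continuous (by fun_prop)), sum_hardySq_eq_circleAverage,
      Real.circleAverage_const]
  rw [h1, sum_hardySq_eq_circleAverage]
  refine Real.circleAverage_mono (circleIntegrable_of_continuous (by fun_prop))
      (circleIntegrable_of_continuous (by fun_prop)) fun z hz => h z ?_
  simpa using hz

/-- Multiplication by a polynomial bounded by `P` on the unit circle. -/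
theorem hardySq_mul_le {p : ℂ[X]} {P : ℝ} (hp : ∀ z : ℂ, ‖z‖ = 1 → ‖p.eval z‖ ≤ P) (f : ℂ[X]) :
    hardySq (p * f) ≤ P ^ 2 * hardySq f := by
  have h := sum_hardySq_le_of_circle (f := fun _ : Unit => p * f)
    (g := fun _ : Unit => C (P : ℂ) * f) (c := 0) fun z hz => by
      simp only [eval_mul, eval_C, norm_mul, mul_pow, univ_unique, sum_singleton, add_zero,
        Complex.norm_real, Real.norm_eq_abs, sq_abs]
      gcongr
      exact hp z hz
  simpa [hardySq_C_mul] using h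

/-- Multiplication by `p` is lower triangular on coefficients: the first `M` coefficients of `p * f`
only see those of `f`. Truncating `f` therefore reduces this to the multiplier bound. -/
theorem sum_sq_coeff_mul_le {p : ℂ[X]} {P : ℝ} (hp : ∀ z : ℂ, ‖z‖ = 1 → ‖p.eval z‖ ≤ P)
    (f : ℂ[X]) (M : ℕ) :
    ∑ m ∈ range M, ‖(p * f).coeff m‖ ^ 2 ≤ P ^ 2 * ∑ m ∈ range M, ‖f.coeff m‖ ^ 2 := by
  set g : ℂ[X] := ∑ i ∈ range M, monomial i (f.coeff i) with hg
  have hgc : ∀ n, g.coeff n = if n < M then f.coeff n else 0 := by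
    intro n
    simp [hg, coeff_monomial]
  have h1 : ∀ m ∈ range M, (p * f).coeff m = (p * g).coeff m := by
    intro m hm
    rw [coeff_mul, coeff_mul]
    refine Finset.sum_congr rfl fun x hx => ?_
    have : x.2 < M := by
      have := mem_antidiagonal.mp hx
      have := mem_range.mp hm
      omega
    rw [hgc, if_pos this]
  calc ∑ m ∈ range M, ‖(p * f).coeff m‖ ^ 2 = ∑ m ∈ range M, ‖(p * g).coeff m‖ ^ 2 :=
        Finset.sum_congr rfl fun m hm => by rw [h1 m hm]
    _ ≤ hardySq (p * g) := sum_sq_coeff_le_hardySq _ _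
    _ ≤ P ^ 2 * hardySq g := hardySq_mul_le hp g
    _ = P ^ 2 * ∑ m ∈ range M, ‖f.coeff m‖ ^ 2 := by
        rw [hardySq_eq_sum_range (M := M) fun n hn => by rw [hgc, if_neg (not_lt.mpr hn)]]
        congr 1
        refine Finset.sum_congr rfl fun m hm => by rw [hgc, if_pos (mem_range.mp hm)]

theorem norm_coeff_le_of_circle {p : ℂ[X]} {P : ℝ} (hp : ∀ z : ℂ, ‖z‖ = 1 → ‖p.eval z‖ ≤ P)
    (n : ℕ) : ‖p.coeff n‖ ≤ P := by
  have hP : 0 ≤ P := (norm_nonneg _).trans (hp 1 (by simp))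
  have h1 : hardySq (1 : ℂ[X]) = 1 := by
    rw [hardySq_eq_sum_range (M := 1) fun n hn => by rw [coeff_one, if_neg (by omega)]]
    simp
  have h := (sum_sq_coeff_le_hardySq (p * 1) {n}).trans (hardySq_mul_le hp 1)
  rw [h1] at h
  simp only [mul_one, sum_singleton] at h
  exact le_of_sq_le_sq h hP

/-! ### Estimates from the tail condition on the coefficients. -/

section Tail

variable {N : ℕ} {α : ℕ → ℂ}

/-- The tail condition `(m + 1)² ∑_{j ≥ m} |α_j|² ≤ 1`, tested against a sequence. -/
theorem sum_tail_le (hα : ∀ m ≤ N, ((m : ℝ) + 1) ^ 2 * ∑ j ∈ Icc m N, ‖α j‖ ^ 2 ≤ 1)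
    {c : ℕ → ℝ} (hc : ∀ m, 0 ≤ c m) :
    ∑ j ∈ range (N + 1), ‖α j‖ ^ 2 * ∑ m ∈ range (j + 1), ((m : ℝ) + 1) ^ 2 * c m ≤
      ∑ m ∈ range (N + 1), c m := by
  have : ∑ j ∈ range (N + 1), ‖α j‖ ^ 2 * ∑ m ∈ range (j + 1), ((m : ℝ) + 1) ^ 2 * c m =
      ∑ m ∈ range (N + 1), (((m : ℝ) + 1) ^ 2 * ∑ j ∈ Icc m N, ‖α j‖ ^ 2) * c m := by
    simp_rw [Finset.mul_sum, Finset.sum_mul]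
    rw [Finset.sum_comm' (t' := range (N + 1)) (s' := fun m => Icc m N)]
    · exact Finset.sum_congr rfl fun m _ => Finset.sum_congr rfl fun j _ => by ring
    · intro j m
      simp only [mem_range, mem_Icc]
      omega
  rw [this]
  refine Finset.sum_le_sum fun m hm => ?_
  have h := hα m (by have := mem_range.mp hm; omega)
  nlinarith [hc m]

/-- Writing `p'φ = (pφ)' - pφ'` avoids any bound on `p'`. In the first term the tail condition
absorbs the factors `m + 1` coming from the derivative; in the second, `p` is removed by the
truncated multiplier bound and the tail condition is applied to `φ'`. Each term costs `P²`, and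
squaring the difference doubles both. -/
theorem sum_tail_sq_deriv_mul_le
    (hα : ∀ m ≤ N, ((m : ℝ) + 1) ^ 2 * ∑ j ∈ Icc m N, ‖α j‖ ^ 2 ≤ 1)
    {p : ℂ[X]} {P : ℝ} (hp : ∀ z : ℂ, ‖z‖ = 1 → ‖p.eval z‖ ≤ P) (φ : ℂ[X]) :
    ∑ j ∈ range (N + 1), ‖α j‖ ^ 2 * ∑ m ∈ range (j + 1), ‖(derivative p * φ).coeff m‖ ^ 2 ≤
      4 * P ^ 2 * hardySq φ := by
  have hder : ∀ (q : ℂ[X]) (m : ℕ), ‖(derivative q).coeff m‖ ^ 2 =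
      ((m : ℝ) + 1) ^ 2 * ‖q.coeff (m + 1)‖ ^ 2 := by
    intro q m
    have : ‖(m : ℂ) + 1‖ = (m : ℝ) + 1 := by
      have := Complex.norm_natCast (m + 1)
      push_cast at this
      exact this
    rw [coeff_derivative, norm_mul, this]
    ring
  have hshift : ∀ q : ℂ[X], ∑ m ∈ range (N + 1), ‖q.coeff (m + 1)‖ ^ 2 ≤ hardySq q := by
    intro q
    have h := sum_sq_coeff_le_hardySq q (range (N + 2))
    rw [Finset.sum_range_succ'] at h
    nlinarith [sq_nonneg ‖q.coeff 0‖]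
  have hA : ∑ j ∈ range (N + 1), ‖α j‖ ^ 2 *
      ∑ m ∈ range (j + 1), ‖(derivative (p * φ)).coeff m‖ ^ 2 ≤ P ^ 2 * hardySq φ := by
    simp_rw [hder]
    exact (sum_tail_le hα fun m => by positivity).trans ((hshift _).trans (hardySq_mul_le hp φ))
  have hB : ∑ j ∈ range (N + 1), ‖α j‖ ^ 2 *
      ∑ m ∈ range (j + 1), ‖(p * derivative φ).coeff m‖ ^ 2 ≤ P ^ 2 * hardySq φ := by
    calc _ ≤ ∑ j ∈ range (N + 1), ‖α j‖ ^ 2 *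
          (P ^ 2 * ∑ m ∈ range (j + 1), ‖(derivative φ).coeff m‖ ^ 2) :=
          Finset.sum_le_sum fun j _ => by
            gcongr
            exact sum_sq_coeff_mul_le hp _ _
      _ = P ^ 2 * ∑ j ∈ range (N + 1), ‖α j‖ ^ 2 *
          ∑ m ∈ range (j + 1), ((m : ℝ) + 1) ^ 2 * ‖φ.coeff (m + 1)‖ ^ 2 := by
          rw [Finset.mul_sum]
          refine Finset.sum_congr rfl fun j _ => ?_
          simp_rw [hder]
          ring
      _ ≤ P ^ 2 * hardySq φ := by
          gcongr
          exact (sum_tail_le hα fun m => by positivity).trans (hshift _)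
  have hle : ∀ m, ‖(derivative p * φ).coeff m‖ ^ 2 ≤
      2 * ‖(derivative (p * φ)).coeff m‖ ^ 2 + 2 * ‖(p * derivative φ).coeff m‖ ^ 2 := by
    intro m
    have : derivative p * φ = derivative (p * φ) - p * derivative φ := by
      rw [derivative_mul]; ring
    rw [this, coeff_sub]
    have h := norm_sub_le ((derivative (p * φ)).coeff m) ((p * derivative φ).coeff m)
    nlinarith [norm_nonneg ((derivative (p * φ)).coeff m - (p * derivative φ).coeff m),
      sq_nonneg (‖(derivative (p * φ)).coeff m‖ - ‖(p * derivative φ).coeff m‖)]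
  calc _ ≤ ∑ j ∈ range (N + 1), ‖α j‖ ^ 2 * ∑ m ∈ range (j + 1),
        (2 * ‖(derivative (p * φ)).coeff m‖ ^ 2 + 2 * ‖(p * derivative φ).coeff m‖ ^ 2) :=
        Finset.sum_le_sum fun j _ => by
          gcongr
          exact hle _
    _ = 2 * (∑ j ∈ range (N + 1), ‖α j‖ ^ 2 *
          ∑ m ∈ range (j + 1), ‖(derivative (p * φ)).coeff m‖ ^ 2) +
        2 * (∑ j ∈ range (N + 1), ‖α j‖ ^ 2 *
          ∑ m ∈ range (j + 1), ‖(p * derivative φ).coeff m‖ ^ 2) := by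
        rw [Finset.mul_sum, Finset.mul_sum, ← Finset.sum_add_distrib]
        refine Finset.sum_congr rfl fun j _ => ?_
        rw [Finset.sum_add_distrib, ← Finset.mul_sum, ← Finset.mul_sum]
        ring
    _ ≤ _ := by linarith

theorem sq_norm_coeff_mul_le (x y : ℂ[X]) (j : ℕ) :
    ‖(x * y).coeff j‖ ^ 2 ≤ (∑ m ∈ range (j + 1), ‖x.coeff m‖ ^ 2) * hardySq y := by
  rw [coeff_mul, Finset.Nat.sum_antidiagonal_eq_sum_range_succ
    (fun m l => x.coeff m * y.coeff l) j]
  have h1 : ‖∑ m ∈ range (j + 1), x.coeff m * y.coeff (j - m)‖ ≤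
      ∑ m ∈ range (j + 1), ‖x.coeff m‖ * ‖y.coeff (j - m)‖ :=
    (norm_sum_le _ _).trans_eq (by simp)
  have h2 := Finset.sum_mul_sq_le_sq_mul_sq (range (j + 1)) (fun m => ‖x.coeff m‖)
    (fun m => ‖y.coeff (j - m)‖)
  have h3 : ∑ m ∈ range (j + 1), ‖y.coeff (j - m)‖ ^ 2 ≤ hardySq y := by
    have := Finset.sum_range_reflect (fun m => ‖y.coeff m‖ ^ 2) (j + 1)
    simp only [Nat.add_sub_cancel] at this
    rw [this]
    exact sum_sq_coeff_le_hardySq _ _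
  calc _ ≤ (∑ m ∈ range (j + 1), ‖x.coeff m‖ * ‖y.coeff (j - m)‖) ^ 2 := by gcongr
    _ ≤ _ := h2
    _ ≤ _ := by gcongr

/-- The basic estimate: the `j`-th coefficients of the products of the derivative of `p` with
`φ ω_j`, weighted by `α_j`. -/
theorem norm_sum_coeff_deriv_mul_le
    (hα : ∀ m ≤ N, ((m : ℝ) + 1) ^ 2 * ∑ j ∈ Icc m N, ‖α j‖ ^ 2 ≤ 1)
    {p : ℂ[X]} {P : ℝ} (hp : ∀ z : ℂ, ‖z‖ = 1 → ‖p.eval z‖ ≤ P) (φ : ℂ[X]) (ω : ℕ → ℂ[X]) :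
    ‖∑ j ∈ range (N + 1), α j * (derivative p * (φ * ω j)).coeff j‖ ^ 2 ≤
      4 * P ^ 2 * hardySq φ * ∑ j ∈ range (N + 1), hardySq (ω j) := by
  set X : ℕ → ℝ := fun j => ∑ m ∈ range (j + 1), ‖(derivative p * φ).coeff m‖ ^ 2 with hX
  have hX0 : ∀ j, 0 ≤ X j := fun j => Finset.sum_nonneg fun _ _ => by positivity
  have h1 : ‖∑ j ∈ range (N + 1), α j * (derivative p * (φ * ω j)).coeff j‖ ≤
      ∑ j ∈ range (N + 1), (‖α j‖ * √(X j)) * √(hardySq (ω j)) := by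
    refine (norm_sum_le _ _).trans (Finset.sum_le_sum fun j _ => ?_)
    rw [norm_mul, ← mul_assoc (derivative p), mul_assoc ‖α j‖, ← Real.sqrt_mul (hX0 j)]
    gcongr
    exact Real.le_sqrt_of_sq_le (sq_norm_coeff_mul_le _ _ _)
  -- The weight `α j` stays with the factor `p'φ`, where the tail condition can absorb it.
  have h2 := Finset.sum_mul_sq_le_sq_mul_sq (range (N + 1)) (fun j => ‖α j‖ * √(X j))
    (fun j => √(hardySq (ω j)))
  simp only [mul_pow, Real.sq_sqrt (hX0 _), Real.sq_sqrt (hardySq_nonneg _)] at h2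
  calc _ ≤ (∑ j ∈ range (N + 1), (‖α j‖ * √(X j)) * √(hardySq (ω j))) ^ 2 := by gcongr
    _ ≤ _ := h2
    _ ≤ _ := by
      gcongr
      · exact Finset.sum_nonneg fun _ _ => hardySq_nonneg _
      · exact sum_tail_sq_deriv_mul_le hα hp φ

end Tail

/-! ### Approximate outer functions by polynomials. -/

/-- A trigonometric polynomial is the sum of an analytic and an antianalytic polynomial. -/
theorem exists_polynomial_of_mem_span_fourier {t : C(AddCircle (1 : ℝ), ℂ)}
    (ht : t ∈ Submodule.span ℂ (Set.range (@fourier (1 : ℝ)))) :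
    ∃ A B : ℂ[X], ∀ x : AddCircle (1 : ℝ), t x =
      A.eval (AddCircle.toCircle x : ℂ) +
        starRingEnd ℂ (B.eval (AddCircle.toCircle x : ℂ)) := by
  induction ht using Submodule.span_induction with
  | mem t h =>
    obtain ⟨n, rfl⟩ := h
    obtain ⟨n, rfl | rfl⟩ := n.eq_nat_or_neg
    · exact ⟨X ^ n, 0, fun x => by simp [fourier_apply, AddCircle.toCircle_nsmul]⟩
    · refine ⟨0, X ^ n, fun x => ?_⟩
      rw [fourier_neg]
      simp [fourier_apply, AddCircle.toCircle_nsmul]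
  | zero => exact ⟨0, 0, fun x => by simp⟩
  | add s t _ _ hs ht =>
    obtain ⟨A, B, h⟩ := hs
    obtain ⟨A', B', h'⟩ := ht
    refine ⟨A + A', B + B', fun x => ?_⟩
    simp only [ContinuousMap.add_apply, h, h', eval_add, map_add]
    ring
  | smul c t _ ht =>
    obtain ⟨A, B, h⟩ := ht
    refine ⟨C c * A, C (starRingEnd ℂ c) * B, fun x => ?_⟩
    simp only [ContinuousMap.smul_apply, h, eval_mul, eval_C, map_mul, smul_eq_mul,
      RingHomCompTriple.comp_apply, RingHom.id_apply]
    ring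

/-- Real parts of polynomials are dense in the continuous functions on the circle. -/
theorem exists_polynomial_re_approx {F : ℂ → ℝ} (hF : Continuous F) {δ : ℝ} (hδ : 0 < δ) :
    ∃ H : ℂ[X], ∀ z : ℂ, ‖z‖ = 1 → |F z - (H.eval z).re| ≤ δ := by
  let f : C(AddCircle (1 : ℝ), ℂ) :=
    ⟨fun x => (F (AddCircle.toCircle x : ℂ) : ℂ), by
      exact Complex.continuous_ofReal.comp
        (hF.comp (continuous_subtype_val.comp AddCircle.continuous_toCircle))⟩
  have hf : f ∈ (Submodule.span ℂ (Set.range (@fourier (1 : ℝ)))).topologicalClosure := by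
    rw [span_fourier_closure_eq_top]
    trivial
  obtain ⟨t, ht, htf⟩ := Metric.mem_closure_iff.mp hf δ hδ
  obtain ⟨A, B, h⟩ := exists_polynomial_of_mem_span_fourier ht
  -- Removing the conjugation from the antianalytic part leaves its real part unchanged, and `F` is
  -- real.
  refine ⟨A + B, fun z hz => ?_⟩
  obtain ⟨x, hx⟩ := (AddCircle.homeomorphCircle (T := 1) one_ne_zero).surjective
    ⟨z, by simpa [Submonoid.unitSphere] using hz⟩
  rw [AddCircle.homeomorphCircle_apply] at hx
  have hx' : (AddCircle.toCircle x : ℂ) = z := by rw [hx]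
  have h1 : ‖f x - t x‖ ≤ δ := by
    rw [← dist_eq_norm]
    exact (ContinuousMap.dist_apply_le_dist x).trans htf.le
  refine le_trans ?_ h1
  refine le_trans (le_of_eq ?_) (Complex.abs_re_le_norm _)
  rw [h x]
  simp [f, hx']

/-- The exponential of a polynomial is a uniform limit of polynomials on the circle. -/
theorem exists_polynomial_exp_approx (Q : ℂ[X]) {τ : ℝ} (hτ : 0 < τ) :
    ∃ E : ℂ[X], ∀ z : ℂ, ‖z‖ = 1 → ‖E.eval z - Complex.exp (Q.eval z)‖ ≤ τ := by
  obtain ⟨R, hR⟩ := (isCompact_sphere (0 : ℂ) 1).exists_bound_of_continuousOn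
    (f := fun z => Q.eval z) (by fun_prop)
  have hR' : ∀ z : ℂ, ‖z‖ = 1 → ‖Q.eval z‖ ≤ R := fun z hz => hR z (by simpa using hz)
  have hu : Summable fun n : ℕ => R ^ n / (n.factorial : ℝ) := Real.summable_pow_div_factorial R
  have h := tendstoUniformlyOn_tsum_nat (f := fun n w => w ^ n / (n.factorial : ℂ)) hu
    (s := {w : ℂ | ‖w‖ ≤ R}) fun n w hw => by
      rw [norm_div, norm_pow, Complex.norm_natCast]
      have : ‖w‖ ≤ R := hw
      gcongr
  rw [Metric.tendstoUniformlyOn_iff] at h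
  obtain ⟨n, hn⟩ := (h τ hτ).exists
  refine ⟨∑ i ∈ range n, C ((i.factorial : ℂ)⁻¹) * Q ^ i, fun z hz => ?_⟩
  have h2 := hn (Q.eval z) (hR' z hz)
  rw [dist_comm, dist_eq_norm] at h2
  have h3 : ∑' n : ℕ, Q.eval z ^ n / (n.factorial : ℂ) = Complex.exp (Q.eval z) := by
    rw [Complex.exp_eq_exp_ℂ, NormedSpace.exp_eq_tsum_div]
  rw [h3] at h2
  refine le_trans (le_of_eq ?_) h2.le
  congr 2
  rw [eval_finsetSum]
  refine Finset.sum_congr rfl fun i _ => ?_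
  rw [eval_mul, eval_C, eval_pow]
  ring

/-- Approximate outer factorization: the function `∑ |u_x|²` on the circle is almost the
squared modulus of a polynomial with an almost inverse polynomial. -/
theorem exists_approx_outer {κ : Type*} [Fintype κ] (u : κ → ℂ[X]) {η : ℝ} (hη : 0 < η) :
    ∃ φ ψ : ℂ[X], ∀ z : ℂ, ‖z‖ = 1 →
      ‖φ.eval z‖ ^ 2 ≤ ∑ x, ‖(u x).eval z‖ ^ 2 + η ∧
      ‖ψ.eval z‖ ^ 2 * ∑ x, ‖(u x).eval z‖ ^ 2 ≤ 1 + η ∧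
      ‖φ.eval z * ψ.eval z - 1‖ ≤ η := by
  set g : ℂ → ℝ := fun z => ∑ x, ‖(u x).eval z‖ ^ 2 with hg
  have hg0 : ∀ z, 0 ≤ g z := fun z => Finset.sum_nonneg fun _ _ => by positivity
  have hgc : Continuous g := by fun_prop
  have hgpos : ∀ z, 0 < g z + η / 2 := fun z => by have := hg0 z; positivity
  obtain ⟨δ, hδ, hδη⟩ : ∃ δ : ℝ, 0 < δ ∧ Real.exp (2 * δ) ≤ 1 + η / 2 := by
    have hlog := Real.log_pos (x := 1 + η / 2) (by linarith)
    refine ⟨Real.log (1 + η / 2) / 2, by positivity, ?_⟩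
    rw [mul_div_cancel₀ _ two_ne_zero, Real.exp_log (by positivity)]
  -- The summand `η / 2` keeps the logarithm finite at zeros of `g`. The shift by `δ` makes the
  -- approximation one-sided: `Re H` lies between `log (g + η / 2) - 2δ` and `log (g + η / 2)`.
  obtain ⟨H, hH⟩ := exists_polynomial_re_approx (F := fun z => Real.log (g z + η / 2) - δ)
    ((Continuous.log (by fun_prop) fun z => (hgpos z).ne').sub continuous_const) hδ
  set Q : ℂ[X] := C (1 / 2 : ℂ) * H with hQ
  have hsq : ∀ z, ‖Complex.exp (Q.eval z)‖ ^ 2 = Real.exp (H.eval z).re := by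
    intro z
    rw [Complex.norm_exp, ← Real.exp_nat_mul, hQ]
    simp
  have hsq' : ∀ z, ‖Complex.exp ((-Q).eval z)‖ ^ 2 = Real.exp (-(H.eval z).re) := by
    intro z
    rw [Complex.norm_exp, ← Real.exp_nat_mul, hQ]
    simp
  have hup : ∀ z : ℂ, ‖z‖ = 1 → ‖Complex.exp (Q.eval z)‖ ^ 2 ≤ g z + η / 2 := by
    intro z hz
    have := abs_le.mp (hH z hz)
    rw [hsq, ← Real.exp_log (hgpos z)]
    exact Real.exp_le_exp.mpr (by linarith [this.1])
  have hlow : ∀ z : ℂ, ‖z‖ = 1 → ‖Complex.exp ((-Q).eval z)‖ ^ 2 * g z ≤ 1 + η / 2 := by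
    intro z hz
    have := abs_le.mp (hH z hz)
    calc _ ≤ Real.exp (-(H.eval z).re) * (g z + η / 2) := by
          rw [hsq']
          gcongr
          linarith
      _ = Real.exp (-(H.eval z).re + Real.log (g z + η / 2)) := by
          rw [Real.exp_add, Real.exp_log (hgpos z)]
      _ ≤ Real.exp (2 * δ) := Real.exp_le_exp.mpr (by linarith [this.2])
      _ ≤ _ := hδη
  obtain ⟨R, hR1, hRf, hRi, hRg⟩ : ∃ R : ℝ, 1 ≤ R ∧
      (∀ z : ℂ, ‖z‖ = 1 → ‖Complex.exp (Q.eval z)‖ ≤ R) ∧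
      (∀ z : ℂ, ‖z‖ = 1 → ‖Complex.exp ((-Q).eval z)‖ ≤ R) ∧ ∀ z : ℂ, ‖z‖ = 1 → g z ≤ R := by
    obtain ⟨R, hR⟩ := (isCompact_sphere (0 : ℂ) 1).exists_bound_of_continuousOn
      (f := fun z => 1 + ‖Complex.exp (Q.eval z)‖ + ‖Complex.exp ((-Q).eval z)‖ + g z)
      (by fun_prop)
    have key : ∀ z : ℂ, ‖z‖ = 1 →
        1 + ‖Complex.exp (Q.eval z)‖ + ‖Complex.exp ((-Q).eval z)‖ + g z ≤ R := fun z hz =>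
      (le_abs_self _).trans (hR z (by simpa using hz))
    have n1 : ∀ z, 0 ≤ ‖Complex.exp (Q.eval z)‖ := fun z => norm_nonneg _
    have n2 : ∀ z, 0 ≤ ‖Complex.exp ((-Q).eval z)‖ := fun z => norm_nonneg _
    refine ⟨R, ?_, fun z hz => ?_, fun z hz => ?_, fun z hz => ?_⟩
    · linarith [key 1 (by simp), n1 1, n2 1, hg0 1]
    all_goals linarith [key z hz, n1 z, n2 z, hg0 z]
  -- An error `τ ≤ 1` in a quantity of modulus at most `R` changes its square by at most `τ (2R +
  -- 1)`; the additional factor `R` pays for multiplication by `g`.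
  obtain ⟨τ, hτ0, hτ1, hτη⟩ : ∃ τ : ℝ, 0 < τ ∧ τ ≤ 1 ∧ τ * (2 * R + 1) * R ≤ η / 2 := by
    refine ⟨min 1 (η / 2 / ((2 * R + 1) * R)), by positivity, min_le_left _ _, ?_⟩
    calc _ ≤ η / 2 / ((2 * R + 1) * R) * ((2 * R + 1) * R) := by
          rw [mul_assoc]
          gcongr
          exact min_le_right _ _
      _ = η / 2 := div_mul_cancel₀ _ (by positivity)
  obtain ⟨φ, hφ⟩ := exists_polynomial_exp_approx Q hτ0
  obtain ⟨ψ, hψ⟩ := exists_polynomial_exp_approx (-Q) hτ0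
  have hτη' : τ * (2 * R + 1) ≤ η / 2 := by nlinarith
  have hpert : ∀ a b : ℂ, ‖a - b‖ ≤ τ → ‖b‖ ≤ R → ‖a‖ ^ 2 ≤ ‖b‖ ^ 2 + τ * (2 * R + 1) := by
    intro a b hab hb
    have h1 : ‖a‖ ≤ ‖b‖ + τ := by
      have := norm_add_le (a - b) b
      rw [sub_add_cancel] at this
      linarith
    have : ‖a‖ ^ 2 ≤ (‖b‖ + τ) ^ 2 := by gcongr
    nlinarith [norm_nonneg b]
  refine ⟨φ, ψ, fun z hz => ⟨?_, ?_, ?_⟩⟩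
  · have := hpert _ _ (hφ z hz) (hRf z hz)
    have := hup z hz
    show _ ≤ g z + η
    linarith
  · have h1 := hpert _ _ (hψ z hz) (hRi z hz)
    show _ * g z ≤ _
    have h2 := hlow z hz
    have h3 : ‖ψ.eval z‖ ^ 2 * g z ≤
        (‖Complex.exp ((-Q).eval z)‖ ^ 2 + τ * (2 * R + 1)) * g z := by
      gcongr
    have h4 : τ * (2 * R + 1) * g z ≤ τ * (2 * R + 1) * R := by
      gcongr
      exact hRg z hz
    linarith
  · have hone : Complex.exp (Q.eval z) * Complex.exp ((-Q).eval z) = 1 := by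
      rw [← Complex.exp_add, eval_neg, add_neg_cancel, Complex.exp_zero]
    have hdec : φ.eval z * ψ.eval z - 1 = (φ.eval z - Complex.exp (Q.eval z)) * ψ.eval z +
        Complex.exp (Q.eval z) * (ψ.eval z - Complex.exp ((-Q).eval z)) := by
      rw [← hone]
      ring
    have hψn : ‖ψ.eval z‖ ≤ R + τ := by
      have := norm_add_le (ψ.eval z - Complex.exp ((-Q).eval z)) (Complex.exp ((-Q).eval z))
      rw [sub_add_cancel] at this
      linarith [hψ z hz, hRi z hz]
    rw [hdec]
    refine (norm_add_le _ _).trans ?_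
    rw [norm_mul, norm_mul]
    have h1 : ‖φ.eval z - Complex.exp (Q.eval z)‖ * ‖ψ.eval z‖ ≤ τ * (R + τ) :=
      mul_le_mul (hφ z hz) hψn (norm_nonneg _) hτ0.le
    have h2 : ‖Complex.exp (Q.eval z)‖ * ‖ψ.eval z - Complex.exp ((-Q).eval z)‖ ≤ R * τ :=
      mul_le_mul (hRf z hz) (hψ z hz) (norm_nonneg _) (by linarith)
    nlinarith

/-! ### The bilinear estimate via outer factorization. -/

/-- The basic bilinear estimate for a family of matrices `A_j` for which
`∑ |⟨A_j a, b⟩|² ≤ ‖a‖² ‖b‖²`. -/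
theorem norm_sum_coeff_deriv_bilin_le {κ : Type*} [Fintype κ] {N : ℕ} {α : ℕ → ℂ}
    (hα : ∀ m ≤ N, ((m : ℝ) + 1) ^ 2 * ∑ j ∈ Icc m N, ‖α j‖ ^ 2 ≤ 1)
    {A : ℕ → Matrix κ κ ℂ}
    (hA : ∀ a b : κ → ℂ, ∑ j ∈ range (N + 1), ‖∑ x, ∑ y, A j x y * (b x * a y)‖ ^ 2 ≤
      (∑ x, ‖a x‖ ^ 2) * ∑ x, ‖b x‖ ^ 2)
    {p : ℂ[X]} {P : ℝ} (hp : ∀ z : ℂ, ‖z‖ = 1 → ‖p.eval z‖ ≤ P) (u v : κ → ℂ[X]) :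
    ‖∑ j ∈ range (N + 1),
        α j * (derivative p * ∑ x, ∑ y, C (A j x y) * (v x * u y)).coeff j‖ ≤
      2 * P * (√(∑ x, hardySq (u x)) * √(∑ x, hardySq (v x))) := by
  have hP : 0 ≤ P := (norm_nonneg _).trans (hp 1 (by simp))
  set w : ℕ → ℂ[X] := fun j => ∑ x, ∑ y, C (A j x y) * (v x * u y) with hw
  have hwe : ∀ j z, (w j).eval z = ∑ x, ∑ y, A j x y * ((v x).eval z * (u y).eval z) := by
    intro j z
    simp [hw, eval_finsetSum]
  set U := ∑ x, hardySq (u x)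
  set V := ∑ x, hardySq (v x)
  have hU : 0 ≤ U := Finset.sum_nonneg fun _ _ => hardySq_nonneg _
  have hV : 0 ≤ V := Finset.sum_nonneg fun _ _ => hardySq_nonneg _
  -- These crude bounds depend on `p'`, but they only enter multiplied by `η` and disappear in the
  -- limit.
  have hB : ∀ j, ∃ B, ∀ z : ℂ, ‖z‖ = 1 → ‖(derivative p * w j).eval z‖ ≤ B := by
    intro j
    obtain ⟨R, hR⟩ := (isCompact_sphere (0 : ℂ) 1).exists_bound_of_continuousOn
      (f := fun z => (derivative p * w j).eval z) (by fun_prop)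
    exact ⟨R, fun z hz => hR z (by simpa using hz)⟩
  choose B hB using hB
  set L : (ℕ → ℂ[X]) → ℂ := fun w =>
    ∑ j ∈ range (N + 1), α j * (derivative p * w j).coeff j with hL
  have key : ∀ η : ℝ, 0 < η → ‖L w‖ ≤ √(4 * P ^ 2 * (U + η) * ((1 + η) * V)) +
      η * ∑ j ∈ range (N + 1), ‖α j‖ * B j := by
    intro η hη
    obtain ⟨φ, ψ, h⟩ := exists_approx_outer u hη
    have h1 : hardySq φ ≤ U + η := by
      have := sum_hardySq_le_of_circle (f := fun _ : Unit => φ) (g := u) (c := η)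
        fun z hz => by simpa using (h z hz).1
      simpa using this
    -- Here `ψ * w j` plays the role of `w j / φ`: by `hA` at each point of the circle, `∑ |w j|²`
    -- is at most `∑ |u|² ∑ |v|²`, and `|ψ|²` cancels the first factor up to `1 + η`.
    have h2 : ∑ j ∈ range (N + 1), hardySq (ψ * w j) ≤ (1 + η) * V := by
      have hs : ‖(√(1 + η) : ℂ)‖ ^ 2 = 1 + η := by
        rw [Complex.norm_real, Real.norm_eq_abs, sq_abs, Real.sq_sqrt (by positivity)]
      have := sum_hardySq_le_of_circle (f := fun j : Fin (N + 1) => ψ * w j)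
        (g := fun x => C (√(1 + η) : ℂ) * v x) (c := 0) fun z hz => by
          simp only [eval_mul, norm_mul, mul_pow, eval_C, add_zero, hs]
          rw [Fin.sum_univ_eq_sum_range (fun j => ‖ψ.eval z‖ ^ 2 * ‖(w j).eval z‖ ^ 2),
            ← Finset.mul_sum, ← Finset.mul_sum]
          simp_rw [hwe]
          calc _ ≤ ‖ψ.eval z‖ ^ 2 * ((∑ x, ‖(u x).eval z‖ ^ 2) * ∑ x, ‖(v x).eval z‖ ^ 2) := by
                gcongr
                exact hA _ _
            _ ≤ (1 + η) * ∑ x, ‖(v x).eval z‖ ^ 2 := by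
                rw [← mul_assoc]
                gcongr
                exact (h z hz).2.1
      rw [Fin.sum_univ_eq_sum_range (fun j => hardySq (ψ * w j))] at this
      simpa only [hardySq_C_mul, hs, ← Finset.mul_sum, add_zero] using this
    have hsplit : L w = L (fun j => φ * (ψ * w j)) + L (fun j => (1 - φ * ψ) * w j) := by
      simp only [hL]
      rw [← Finset.sum_add_distrib]
      refine Finset.sum_congr rfl fun j _ => ?_
      rw [← mul_add, ← coeff_add, ← mul_add]
      congr 3
      ring
    have h3 : ‖L (fun j => φ * (ψ * w j))‖ ≤ √(4 * P ^ 2 * (U + η) * ((1 + η) * V)) := by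
      refine Real.le_sqrt_of_sq_le ((norm_sum_coeff_deriv_mul_le hα hp φ _).trans ?_)
      gcongr
      exact Finset.sum_nonneg fun _ _ => hardySq_nonneg _
    have h4 : ‖L (fun j => (1 - φ * ψ) * w j)‖ ≤ η * ∑ j ∈ range (N + 1), ‖α j‖ * B j := by
      rw [Finset.mul_sum]
      refine (norm_sum_le _ _).trans (Finset.sum_le_sum fun j _ => ?_)
      rw [norm_mul, mul_left_comm η]
      gcongr
      refine norm_coeff_le_of_circle (fun z hz => ?_) j
      have : derivative p * ((1 - φ * ψ) * w j) = (1 - φ * ψ) * (derivative p * w j) := by ring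
      rw [this, eval_mul, norm_mul]
      have h5 := (h z hz).2.2
      rw [norm_sub_rev] at h5
      refine mul_le_mul ?_ (hB j z hz) (norm_nonneg _) hη.le
      simpa using h5
    rw [hsplit]
    exact (norm_add_le _ _).trans (add_le_add h3 h4)
  -- Letting `η` tend to zero removes the error of the approximate factorization.
  have hlim : Filter.Tendsto (fun η : ℝ => √(4 * P ^ 2 * (U + η) * ((1 + η) * V)) +
      η * ∑ j ∈ range (N + 1), ‖α j‖ * B j) (nhdsWithin 0 (Set.Ioi 0))
      (nhds (√(4 * P ^ 2 * (U + 0) * ((1 + 0) * V)) +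
        0 * ∑ j ∈ range (N + 1), ‖α j‖ * B j)) :=
    (Continuous.tendsto (by fun_prop) 0).mono_left nhdsWithin_le_nhds
  have hfin := ge_of_tendsto hlim (Filter.eventually_of_mem self_mem_nhdsWithin key)
  refine hfin.trans (le_of_eq ?_)
  have : 4 * P ^ 2 * (U + 0) * ((1 + 0) * V) = (2 * P) ^ 2 * (U * V) := by ring
  rw [this, Real.sqrt_mul (by positivity), Real.sqrt_sq (by positivity), Real.sqrt_mul hU]
  ring

/-! ### The canonical anticommutation relations -/

section CAR

variable {m : ℕ}

theorem tensorMatrix_mul (A B : Fin m → Matrix (Fin 2) (Fin 2) ℂ) :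
    tensorMatrix A * tensorMatrix B = tensorMatrix fun l => A l * B l := by
  ext x y
  simp only [tensorMatrix, Matrix.mul_apply, Matrix.of_apply, Finset.prod_univ_sum,
    Fintype.piFinset_univ, Finset.prod_mul_distrib]

theorem conjTranspose_tensorMatrix (A : Fin m → Matrix (Fin 2) (Fin 2) ℂ) :
    (tensorMatrix A)ᴴ = tensorMatrix fun l => (A l)ᴴ := by
  ext x y
  simp [tensorMatrix, Matrix.conjTranspose_apply]

/-- A single anticommuting tensor position makes the whole products anticommute when all other
positions commute. -/
theorem tensorMatrix_mul_add_mul_eq_zero {A B : Fin m → Matrix (Fin 2) (Fin 2) ℂ} (k : Fin m)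
    (hk : A k * B k + B k * A k = 0) (h : ∀ l, l ≠ k → A l * B l = B l * A l) :
    tensorMatrix A * tensorMatrix B + tensorMatrix B * tensorMatrix A = 0 := by
  rw [tensorMatrix_mul, tensorMatrix_mul]
  ext x y
  simp only [tensorMatrix, Matrix.add_apply, Matrix.of_apply, Matrix.zero_apply]
  rw [← Finset.mul_prod_erase _ _ (mem_univ k),
    ← Finset.mul_prod_erase _ (fun l => (B l * A l) (x l) (y l)) (mem_univ k)]
  have : ∏ l ∈ univ.erase k, (A l * B l) (x l) (y l) =
      ∏ l ∈ univ.erase k, (B l * A l) (x l) (y l) :=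
    Finset.prod_congr rfl fun l hl => by rw [h l (Finset.ne_of_mem_erase hl)]
  rw [this, ← add_mul, ← Matrix.add_apply, hk]
  simp

theorem tensorMatrix_mul_add_mul_eq_one {A B : Fin m → Matrix (Fin 2) (Fin 2) ℂ} (k : Fin m)
    (hk : A k * B k + B k * A k = 1) (h : ∀ l, l ≠ k → A l * B l = 1)
    (h' : ∀ l, l ≠ k → B l * A l = 1) :
    tensorMatrix A * tensorMatrix B + tensorMatrix B * tensorMatrix A = 1 := by
  rw [tensorMatrix_mul, tensorMatrix_mul]
  ext x y
  simp only [tensorMatrix, Matrix.add_apply, Matrix.of_apply]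
  rw [← Finset.mul_prod_erase _ _ (mem_univ k),
    ← Finset.mul_prod_erase _ (fun l => (B l * A l) (x l) (y l)) (mem_univ k)]
  have h1 : ∏ l ∈ univ.erase k, (A l * B l) (x l) (y l) =
      ∏ l ∈ univ.erase k, (1 : Matrix (Fin 2) (Fin 2) ℂ) (x l) (y l) :=
    Finset.prod_congr rfl fun l hl => by rw [h l (Finset.ne_of_mem_erase hl)]
  have h2 : ∏ l ∈ univ.erase k, (B l * A l) (x l) (y l) =
      ∏ l ∈ univ.erase k, (1 : Matrix (Fin 2) (Fin 2) ℂ) (x l) (y l) :=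
    Finset.prod_congr rfl fun l hl => by rw [h' l (Finset.ne_of_mem_erase hl)]
  rw [h1, h2, ← add_mul, ← Matrix.add_apply, hk,
    Finset.mul_prod_erase _ (fun l => (1 : Matrix (Fin 2) (Fin 2) ℂ) (x l) (y l)) (mem_univ k)]
  simp only [Matrix.one_apply, Finset.prod_ite_zero, Finset.prod_const_one, mem_univ, true_implies,
    funext_iff]

/-- For `i ≠ j` the position `min i j` pairs `V` with `C` or its adjoint, which anticommute, and the
remaining positions commute. For `i = j` the position `i` contributes `C C* + C* C = 1`, and `V² =
1` does the rest. -/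
theorem carMatrix_anticomm {N i j : ℕ} (hi : i ≤ N) (hj : j ≤ N) :
    carMatrix N j * (carMatrix N i)ᴴ + (carMatrix N i)ᴴ * carMatrix N j =
      if i = j then 1 else 0 := by
  rw [carMatrix, carMatrix, conjTranspose_tensorMatrix]
  rcases lt_trichotomy i j with h | h | h
  · rw [if_neg h.ne]
    refine tensorMatrix_mul_add_mul_eq_zero ⟨i, by omega⟩ ?_ fun l hl => ?_
    · ext a b
      fin_cases a <;> fin_cases b <;>
        simp [Matrix.mul_apply, Fin.sum_univ_two, Matrix.conjTranspose_apply, Matrix.vecMul,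
          dotProduct, h]
    · have hl' : (l : ℕ) ≠ i := fun h' => hl (Fin.ext h')
      split_ifs <;> first | omega | 
        (ext a b; fin_cases a <;> fin_cases b <;>
          simp [Matrix.mul_apply, Fin.sum_univ_two, Matrix.conjTranspose_apply])
  · subst h
    rw [if_pos rfl]
    refine tensorMatrix_mul_add_mul_eq_one ⟨i, by omega⟩ ?_ (fun l hl => ?_) (fun l hl => ?_)
    · ext a b
      fin_cases a <;> fin_cases b <;>
        simp [Matrix.mul_apply, Fin.sum_univ_two, Matrix.conjTranspose_apply, Matrix.vecMul,
          dotProduct]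
    all_goals
      have hl' : (l : ℕ) ≠ i := fun h' => hl (Fin.ext h')
      split_ifs <;> 
        (ext a b; fin_cases a <;> fin_cases b <;>
          simp [Matrix.mul_apply, Fin.sum_univ_two, Matrix.conjTranspose_apply])
  · rw [if_neg h.ne']
    refine tensorMatrix_mul_add_mul_eq_zero ⟨j, by omega⟩ ?_ fun l hl => ?_
    · ext a b
      fin_cases a <;> fin_cases b <;>
        simp [Matrix.mul_apply, Fin.sum_univ_two, Matrix.conjTranspose_apply, Matrix.vecMul,
          dotProduct, h]
    · have hl' : (l : ℕ) ≠ j := fun h' => hl (Fin.ext h')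
      split_ifs <;> first | omega | 
        (ext a b; fin_cases a <;> fin_cases b <;>
          simp [Matrix.mul_apply, Fin.sum_univ_two, Matrix.conjTranspose_apply])

theorem sum_carMatrix_mul_conjTranspose_add {N : ℕ} (c : ℕ → ℂ) :
    (∑ j ∈ range (N + 1), c j • carMatrix N j) * (∑ j ∈ range (N + 1), c j • carMatrix N j)ᴴ +
      (∑ j ∈ range (N + 1), c j • carMatrix N j)ᴴ * (∑ j ∈ range (N + 1), c j • carMatrix N j) =
      ((∑ j ∈ range (N + 1), ‖c j‖ ^ 2 : ℝ) : ℂ) • 1 := by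
  rw [Matrix.conjTranspose_sum, Finset.sum_mul_sum, Finset.sum_mul_sum]
  rw [Finset.sum_comm (s := range (N + 1)) (t := range (N + 1))
    (f := fun i j => c i • carMatrix N i * (c j • carMatrix N j)ᴴ), ← Finset.sum_add_distrib]
  have : ∀ i ∈ range (N + 1), ∑ j ∈ range (N + 1), c j • carMatrix N j * (c i • carMatrix N i)ᴴ +
      ∑ j ∈ range (N + 1), (c i • carMatrix N i)ᴴ * c j • carMatrix N j =
      ((‖c i‖ ^ 2 : ℝ) : ℂ) • 1 := by
    intro i hi
    rw [← Finset.sum_add_distrib, Finset.sum_eq_single_of_mem i hi]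
    · rw [Matrix.conjTranspose_smul, smul_mul_smul_comm, smul_mul_smul_comm,
        mul_comm (star (c i)), ← smul_add, carMatrix_anticomm (by have := mem_range.mp hi; omega)
        (by have := mem_range.mp hi; omega), if_pos rfl]
      congr 1
      have := Complex.mul_conj' (c i)
      push_cast
      exact this
    · intro j hj hij
      rw [Matrix.conjTranspose_smul, smul_mul_smul_comm, smul_mul_smul_comm,
        mul_comm (star (c i)), ← smul_add, carMatrix_anticomm (by have := mem_range.mp hi; omega)
        (by have := mem_range.mp hj; omega), if_neg hij.symm, smul_zero]
  rw [Finset.sum_congr rfl this, ← Finset.sum_smul]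
  push_cast
  rfl

theorem star_dotProduct_self_eq {κ : Type*} [Fintype κ] (a : κ → ℂ) :
    star a ⬝ᵥ a = ((∑ x, ‖a x‖ ^ 2 : ℝ) : ℂ) := by
  simp only [dotProduct, Pi.star_apply, Complex.ofReal_sum, RCLike.star_def]
  exact Finset.sum_congr rfl fun x _ => by
    rw [Complex.conj_mul']
    push_cast
    rfl

/-- Evaluating `X X* + X* X = ∑ |c_j|²` on `a` gives `‖X a‖² + ‖X* a‖² = (∑ |c_j|²) ‖a‖²`; the
second term is dropped. -/
theorem sum_sq_sum_carMatrix_mulVec_le {N : ℕ} (c : ℕ → ℂ) (a : (Fin (N + 1) → Fin 2) → ℂ) :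
    ∑ x, ‖((∑ j ∈ range (N + 1), c j • carMatrix N j) *ᵥ a) x‖ ^ 2 ≤
      (∑ j ∈ range (N + 1), ‖c j‖ ^ 2) * ∑ x, ‖a x‖ ^ 2 := by
  set X := ∑ j ∈ range (N + 1), c j • carMatrix N j with hX
  have h := congrArg (fun Y : Matrix _ _ ℂ => star a ⬝ᵥ (Y *ᵥ a))
    (sum_carMatrix_mul_conjTranspose_add (N := N) c)
  rw [← hX] at h
  have e1 : star a ⬝ᵥ ((Xᴴ * X) *ᵥ a) = star (X *ᵥ a) ⬝ᵥ (X *ᵥ a) := by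
    rw [← Matrix.mulVec_mulVec, Matrix.dotProduct_mulVec, Matrix.star_mulVec]
  have e2 : star a ⬝ᵥ ((X * Xᴴ) *ᵥ a) = star (Xᴴ *ᵥ a) ⬝ᵥ (Xᴴ *ᵥ a) := by
    rw [← Matrix.mulVec_mulVec, Matrix.dotProduct_mulVec, Matrix.star_mulVec,
      Matrix.conjTranspose_conjTranspose]
  simp only [Matrix.add_mulVec, dotProduct_add, e1, e2, Matrix.smul_mulVec, Matrix.one_mulVec,
    dotProduct_smul, star_dotProduct_self_eq, smul_eq_mul] at h
  norm_cast at h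
  have h0 : 0 ≤ ∑ x, ‖(Xᴴ *ᵥ a) x‖ ^ 2 := Finset.sum_nonneg fun _ _ => by positivity
  linarith

theorem norm_sum_mul_sq_le {κ : Type*} [Fintype κ] (a b : κ → ℂ) :
    ‖∑ x, a x * b x‖ ^ 2 ≤ (∑ x, ‖a x‖ ^ 2) * ∑ x, ‖b x‖ ^ 2 := by
  have h1 : ‖∑ x, a x * b x‖ ≤ ∑ x, ‖a x‖ * ‖b x‖ :=
    (norm_sum_le _ _).trans_eq (by simp)
  calc _ ≤ (∑ x, ‖a x‖ * ‖b x‖) ^ 2 := by gcongr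
    _ ≤ _ := Finset.sum_mul_sq_le_sq_mul_sq _ _ _

/-- Dual to the norm bound for linear combinations: with `s_j` the bilinear values and `t = ∑
|s_j|²`, the choice `c_j = conj s_j` gives `t ≤ ‖b‖ √t ‖a‖`. The form is bilinear, with no
conjugation of `b`, so that polynomial entries produce polynomials. -/
theorem sum_sq_carMatrix_bilin_le {N : ℕ} (a b : (Fin (N + 1) → Fin 2) → ℂ) :
    ∑ j ∈ range (N + 1), ‖∑ x, ∑ y, carMatrix N j x y * (b x * a y)‖ ^ 2 ≤
      (∑ x, ‖a x‖ ^ 2) * ∑ x, ‖b x‖ ^ 2 := by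
  set s : ℕ → ℂ := fun j => ∑ x, ∑ y, carMatrix N j x y * (b x * a y) with hs
  set t : ℝ := ∑ j ∈ range (N + 1), ‖s j‖ ^ 2 with ht
  have ht0 : 0 ≤ t := Finset.sum_nonneg fun _ _ => by positivity
  have h1 : (t : ℂ) =
      ∑ x, b x * ((∑ j ∈ range (N + 1), star (s j) • carMatrix N j) *ᵥ a) x := by
    have : ∀ x, ((∑ j ∈ range (N + 1), star (s j) • carMatrix N j) *ᵥ a) x =
        ∑ j ∈ range (N + 1), star (s j) * ∑ y, carMatrix N j x y * a y := by
      intro x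
      rw [Matrix.sum_mulVec, Finset.sum_apply]
      simp [Matrix.mulVec, dotProduct, Finset.mul_sum, mul_assoc]
    simp_rw [this, Finset.mul_sum]
    rw [Finset.sum_comm, ht]
    push_cast
    refine Finset.sum_congr rfl fun j _ => ?_
    have e : ((‖s j‖ : ℂ)) ^ 2 = star (s j) * s j := by
      rw [RCLike.star_def, Complex.conj_mul']
    rw [e]
    conv_lhs => rw [hs]
    simp only [Finset.mul_sum]
    refine Finset.sum_congr rfl fun x _ => Finset.sum_congr rfl fun y _ => ?_
    ring
  have h2 := norm_sum_mul_sq_le b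
    ((∑ j ∈ range (N + 1), star (s j) • carMatrix N j) *ᵥ a)
  rw [← h1, Complex.norm_real, Real.norm_eq_abs, sq_abs] at h2
  have h3 := sum_sq_sum_carMatrix_mulVec_le (N := N) (fun j => star (s j)) a
  simp only [norm_star] at h3
  rw [← ht] at h3
  have hb : 0 ≤ ∑ x, ‖b x‖ ^ 2 := Finset.sum_nonneg fun _ _ => by positivity
  have h4 : t ^ 2 ≤ (∑ x, ‖b x‖ ^ 2) * (t * ∑ x, ‖a x‖ ^ 2) :=
    h2.trans (by gcongr)
  rcases ht0.eq_or_lt with h | h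
  · rw [← h]
    exact mul_nonneg (Finset.sum_nonneg fun _ _ => by positivity) hb
  · have : t * t ≤ t * ((∑ x, ‖a x‖ ^ 2) * ∑ x, ‖b x‖ ^ 2) := by nlinarith
    exact le_of_mul_le_mul_left this h

/-- The trace of `C C* + C* C = 1` is `2 ^ (N + 1)`, and both summands have the same trace. -/
theorem sum_carMatrix_sq {N j : ℕ} (hj : j ≤ N) :
    ∑ x, ∑ y, carMatrix N j x y * star (carMatrix N j x y) = 2 ^ N := by
  have h := congrArg Matrix.trace (carMatrix_anticomm hj hj)
  rw [if_pos rfl, Matrix.trace_add, Matrix.trace_mul_comm (carMatrix N j)ᴴ, Matrix.trace_one] at h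
  have e : (carMatrix N j * (carMatrix N j)ᴴ).trace =
      ∑ x, ∑ y, carMatrix N j x y * star (carMatrix N j x y) := by
    simp [Matrix.trace, Matrix.mul_apply]
  rw [e] at h
  simp only [Fintype.card_pi, Fintype.card_fin, Finset.prod_const, Finset.card_univ, pow_succ] at h
  push_cast at h
  linear_combination h / 2

end CAR

/-! ### Functions of the truncated Foguel–Hankel matrix -/

section Blocks

variable {κ : Type*} {N : ℕ}

/-- The corner of the `n`-th power is the sum of the `A^k G D^(n-1-k)`, and the intertwining moves
every `A` across `G`, leaving `n G D^(n-1)`. -/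
theorem aeval_fromBlocks_intertwined {σ : Type*} [Fintype σ] [DecidableEq σ] {A D G : Matrix σ σ ℂ}
    (h : A * G = G * D) (p : ℂ[X]) :
    aeval (fromBlocks A G 0 D) p =
      fromBlocks (aeval A p) (G * aeval D (derivative p)) 0 (aeval D p) := by
  have hpow : ∀ n : ℕ, A ^ n * G = G * D ^ n := by
    intro n
    induction n with
    | zero => simp
    | succ n ih => rw [pow_succ, Matrix.mul_assoc, h, ← Matrix.mul_assoc, ih, Matrix.mul_assoc,
        ← pow_succ]
  induction p using Polynomial.induction_on' with
  | add p q hp hq =>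
    simp only [map_add, hp, hq, Matrix.mul_add, Matrix.fromBlocks_add, add_zero]
  | monomial n c =>
    have key : fromBlocks A G 0 D ^ n =
        fromBlocks (A ^ n) (G * aeval D (derivative (X ^ n : ℂ[X]))) 0 (D ^ n) := by
      induction n with
      | zero => simp [Matrix.fromBlocks_one]
      | succ n ih =>
        rw [pow_succ, ih, Matrix.fromBlocks_multiply, pow_succ X, derivative_mul]
        simp only [Matrix.mul_zero, add_zero, Matrix.zero_mul, zero_add, derivative_X, mul_one,
          map_add, map_mul, aeval_X, map_pow, hpow, Matrix.mul_add, ← pow_succ]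
        rw [add_comm (G * D ^ n), Matrix.mul_assoc]
    rw [← C_mul_X_pow_eq_monomial, derivative_C_mul]
    simp only [map_mul, aeval_C, map_pow, aeval_X, key, Algebra.algebraMap_eq_smul_one,
      smul_mul_assoc, one_mul, Matrix.fromBlocks_smul, Matrix.mul_smul, smul_zero]

/-- The polynomials with coefficient vectors given by the blocks of `f`. -/
noncomputable def blockPoly (f : Fin (N + 1) × κ → ℂ) (x : κ) : ℂ[X] :=
  ∑ k : Fin (N + 1), monomial (k : ℕ) (f (k, x))

/-- The polynomials with coefficient vectors given by the blocks of `f` in reversed order. -/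
noncomputable def revBlockPoly (f : Fin (N + 1) × κ → ℂ) (x : κ) : ℂ[X] :=
  ∑ k : Fin (N + 1), monomial (N - (k : ℕ)) (f (k, x))

theorem coeff_blockPoly (f : Fin (N + 1) × κ → ℂ) (x : κ) (i : Fin (N + 1)) :
    (blockPoly f x).coeff i = f (i, x) := by
  simp [blockPoly, coeff_monomial, Fin.val_inj]

theorem coeff_revBlockPoly (f : Fin (N + 1) × κ → ℂ) (x : κ) (i : Fin (N + 1)) :
    (revBlockPoly f x).coeff (N - i) = f (i, x) := by
  have : ∀ k : Fin (N + 1), N - (k : ℕ) = N - (i : ℕ) ↔ k = i := by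
    intro k
    rw [Fin.ext_iff]
    omega
  simp [revBlockPoly, coeff_monomial, this]

theorem sum_fin_rev {E : Type*} [AddCommMonoid E] (g : ℕ → E) :
    ∑ i : Fin (N + 1), g (N - i) = ∑ m ∈ range (N + 1), g m := by
  rw [Fin.sum_univ_eq_sum_range (fun i => g (N - i)) (N + 1),
    ← Finset.sum_range_reflect g (N + 1)]
  simp

theorem sum_range_coeff_blockPoly [Fintype κ] (f : Fin (N + 1) × κ → ℂ) :
    ∑ x, ∑ m ∈ range (N + 1), ‖(blockPoly f x).coeff m‖ ^ 2 = ∑ ix, ‖f ix‖ ^ 2 := by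
  rw [Fintype.sum_prod_type_right]
  refine Finset.sum_congr rfl fun x _ => ?_
  rw [← Fin.sum_univ_eq_sum_range (fun m => ‖(blockPoly f x).coeff m‖ ^ 2)]
  simp only [coeff_blockPoly]

theorem sum_range_coeff_revBlockPoly [Fintype κ] (f : Fin (N + 1) × κ → ℂ) :
    ∑ x, ∑ m ∈ range (N + 1), ‖(revBlockPoly f x).coeff m‖ ^ 2 = ∑ ix, ‖f ix‖ ^ 2 := by
  rw [Fintype.sum_prod_type_right]
  refine Finset.sum_congr rfl fun x _ => ?_
  rw [← sum_fin_rev (fun m => ‖(revBlockPoly f x).coeff m‖ ^ 2)]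
  simp only [coeff_revBlockPoly]

theorem sum_hardySq_revBlockPoly [Fintype κ] (f : Fin (N + 1) × κ → ℂ) :
    ∑ x, hardySq (revBlockPoly f x) = ∑ ix, ‖f ix‖ ^ 2 := by
  rw [← sum_range_coeff_revBlockPoly]
  refine Finset.sum_congr rfl fun x _ => hardySq_eq_sum_range fun n hn => ?_
  have : ∀ k : Fin (N + 1), N - (k : ℕ) ≠ n := fun k => by omega
  simp [revBlockPoly, coeff_monomial, this]

theorem truncShift_mulVec_apply [Fintype κ] [DecidableEq κ]
    (g : Fin (N + 1) × κ → ℂ) (i : Fin (N + 1)) (x : κ) :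
    (truncShift κ N *ᵥ g) (i, x) = if h : (i : ℕ) < N then g (⟨i + 1, by omega⟩, x) else 0 := by
  simp only [truncShift, Matrix.mulVec, dotProduct, Matrix.of_apply, ite_mul, one_mul, zero_mul]
  split_ifs with h
  · rw [Finset.sum_eq_single_of_mem (⟨i + 1, by omega⟩, x) (mem_univ _)]
    · simp
    · rintro ⟨k, y⟩ _ hne
      rw [if_neg]
      rintro ⟨h1, h2⟩
      exact hne (Prod.ext (Fin.ext h1.symm) h2.symm)
  · refine Finset.sum_eq_zero fun k _ => if_neg ?_
    rintro ⟨h1, -⟩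
    have := k.1.2
    omega

theorem truncShift_conjTranspose_mulVec_apply [Fintype κ] [DecidableEq κ]
    (g : Fin (N + 1) × κ → ℂ) (i : Fin (N + 1))
    (x : κ) : ((truncShift κ N)ᴴ *ᵥ g) (i, x) =
      if h : 0 < (i : ℕ) then g (⟨i - 1, by omega⟩, x) else 0 := by
  simp only [truncShift, Matrix.mulVec, dotProduct, Matrix.conjTranspose_apply, Matrix.of_apply,
    apply_ite star, star_one, star_zero, ite_mul, one_mul, zero_mul]
  split_ifs with h
  · rw [Finset.sum_eq_single_of_mem (⟨i - 1, by omega⟩, x) (mem_univ _)]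
    · rw [if_pos]
      exact ⟨by simp; omega, rfl⟩
    · rintro ⟨k, y⟩ _ hne
      rw [if_neg]
      rintro ⟨h1, h2⟩
      exact hne (Prod.ext (Fin.ext (by simp at h1 ⊢; omega)) h2)
  · refine Finset.sum_eq_zero fun k _ => if_neg ?_
    rintro ⟨h1, -⟩
    omega

/-- The shift lowers the block index, so in reversed order it is multiplication by `X` modulo `X ^
(N + 1)`. Its adjoint is the same in the original order. -/
theorem aeval_truncShift_mulVec_apply [Fintype κ] [DecidableEq κ]
    (p : ℂ[X]) (f : Fin (N + 1) × κ → ℂ) (i : Fin (N + 1))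
    (x : κ) : (aeval (truncShift κ N) p *ᵥ f) (i, x) =
      (p * revBlockPoly f x).coeff (N - i) := by
  induction p using Polynomial.induction_on' with
  | add p q hp hq => rw [map_add, Matrix.add_mulVec, Pi.add_apply, hp, hq, add_mul, coeff_add]
  | monomial n c =>
    have key : ∀ i : Fin (N + 1), (truncShift κ N ^ n *ᵥ f) (i, x) =
        (X ^ n * revBlockPoly f x).coeff (N - i) := by
      induction n with
      | zero =>
        intro i
        simp [coeff_revBlockPoly]
      | succ n ih =>
        intro i
        rw [pow_succ', ← Matrix.mulVec_mulVec, truncShift_mulVec_apply, pow_succ', mul_assoc]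
        split_ifs with h
        · have e : N - (i : ℕ) = (N - ((i : ℕ) + 1)) + 1 := by omega
          rw [ih, e, coeff_X_mul]
        · have e : N - (i : ℕ) = 0 := by omega
          rw [e, mul_coeff_zero, coeff_X_zero, zero_mul]
    rw [← C_mul_X_pow_eq_monomial, map_mul, aeval_C, map_pow, aeval_X,
      Algebra.algebraMap_eq_smul_one, smul_mul_assoc, one_mul, Matrix.smul_mulVec, Pi.smul_apply,
      key, mul_assoc, coeff_C_mul, smul_eq_mul]

theorem aeval_truncShift_conjTranspose_mulVec_apply [Fintype κ] [DecidableEq κ]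
    (p : ℂ[X]) (f : Fin (N + 1) × κ → ℂ)
    (i : Fin (N + 1)) (x : κ) : (aeval (truncShift κ N)ᴴ p *ᵥ f) (i, x) =
      (p * blockPoly f x).coeff i := by
  induction p using Polynomial.induction_on' with
  | add p q hp hq => rw [map_add, Matrix.add_mulVec, Pi.add_apply, hp, hq, add_mul, coeff_add]
  | monomial n c =>
    have key : ∀ i : Fin (N + 1), ((truncShift κ N)ᴴ ^ n *ᵥ f) (i, x) =
        (X ^ n * blockPoly f x).coeff i := by
      induction n with
      | zero =>
        intro i
        simp [coeff_blockPoly]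
      | succ n ih =>
        intro i
        rw [pow_succ', ← Matrix.mulVec_mulVec, truncShift_conjTranspose_mulVec_apply, pow_succ',
          mul_assoc]
        split_ifs with h
        · have e : (i : ℕ) = ((i : ℕ) - 1) + 1 := by omega
          rw [ih]
          conv_rhs => rw [e, coeff_X_mul]
        · have e : (i : ℕ) = 0 := by omega
          rw [e, mul_coeff_zero, coeff_X_zero, zero_mul]
    rw [← C_mul_X_pow_eq_monomial, map_mul, aeval_C, map_pow, aeval_X,
      Algebra.algebraMap_eq_smul_one, smul_mul_assoc, one_mul, Matrix.smul_mulVec, Pi.smul_apply,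
      key, mul_assoc, coeff_C_mul, smul_eq_mul]

theorem sum_sq_aeval_truncShift_le [Fintype κ] [DecidableEq κ]
    {p : ℂ[X]} {P : ℝ} (hp : ∀ z : ℂ, ‖z‖ = 1 → ‖p.eval z‖ ≤ P)
    (f : Fin (N + 1) × κ → ℂ) :
    ∑ ix, ‖(aeval (truncShift κ N) p *ᵥ f) ix‖ ^ 2 ≤ P ^ 2 * ∑ ix, ‖f ix‖ ^ 2 := by
  rw [← sum_range_coeff_revBlockPoly f, Fintype.sum_prod_type_right, Finset.mul_sum]
  refine Finset.sum_le_sum fun x _ => ?_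
  simp only [aeval_truncShift_mulVec_apply]
  rw [sum_fin_rev (fun m => ‖(p * revBlockPoly f x).coeff m‖ ^ 2)]
  exact sum_sq_coeff_mul_le hp _ _

theorem sum_sq_aeval_truncShift_conjTranspose_le [Fintype κ] [DecidableEq κ]
    {p : ℂ[X]} {P : ℝ}
    (hp : ∀ z : ℂ, ‖z‖ = 1 → ‖p.eval z‖ ≤ P) (f : Fin (N + 1) × κ → ℂ) :
    ∑ ix, ‖(aeval (truncShift κ N)ᴴ p *ᵥ f) ix‖ ^ 2 ≤ P ^ 2 * ∑ ix, ‖f ix‖ ^ 2 := by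
  rw [← sum_range_coeff_blockPoly f, Fintype.sum_prod_type_right, Finset.mul_sum]
  refine Finset.sum_le_sum fun x _ => ?_
  simp only [aeval_truncShift_conjTranspose_mulVec_apply]
  rw [Fin.sum_univ_eq_sum_range (fun m => ‖(p * blockPoly f x).coeff m‖ ^ 2)]
  exact sum_sq_coeff_mul_le hp _ _

theorem sum_triangle_eq_sum_antidiagonal {E : Type*} [AddCommMonoid E] (n : ℕ) (F : ℕ → ℕ → E) :
    ∑ b ∈ range n, ∑ c ∈ range n, (if b + c < n then F b c else 0) =
      ∑ j ∈ range n, ∑ bc ∈ antidiagonal j, F bc.1 bc.2 := by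
  rw [← Finset.sum_product', ← Finset.sum_filter, Finset.sum_sigma']
  refine Finset.sum_nbij' (fun bc => ⟨bc.1 + bc.2, bc⟩) (fun s => s.2) ?_ ?_ ?_ ?_ ?_
  · rintro ⟨b, c⟩ h
    simp at h ⊢
    omega
  · rintro ⟨j, b, c⟩ h
    simp at h ⊢
    omega
  · rintro ⟨b, c⟩ h
    rfl
  · rintro ⟨j, b, c⟩ h
    simp at h ⊢
    omega
  · rintro ⟨b, c⟩ h
    rfl

/-- Entries of a Hankel matrix depend only on `i + k`, and the two products lower `i` and `k`
respectively. The boundary terms agree because the matrix vanishes above the antidiagonal. -/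
theorem truncShift_conjTranspose_mul_hankelMatrix [Fintype κ] [DecidableEq κ]
    (A : ℕ → Matrix κ κ ℂ) :
    (truncShift κ N)ᴴ * hankelMatrix N A = hankelMatrix N A * truncShift κ N := by
  have hr : ∀ ix k y, (hankelMatrix N A * truncShift κ N) ix (k, y) =
      if h : 0 < (k : ℕ) then hankelMatrix N A ix (⟨k - 1, by omega⟩, y) else 0 := by
    intro ix k y
    simp only [Matrix.mul_apply, truncShift, Matrix.of_apply, mul_ite, mul_one, mul_zero]
    split_ifs with h
    · rw [Finset.sum_eq_single_of_mem (⟨k - 1, by omega⟩, y) (mem_univ _)]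
      · rw [if_pos]
        exact ⟨by simp; omega, rfl⟩
      · rintro ⟨k', y'⟩ _ hne
        rw [if_neg]
        rintro ⟨h1, h2⟩
        exact hne (Prod.ext (Fin.ext (by simp at h1 ⊢; omega)) h2)
    · refine Finset.sum_eq_zero fun k _ => if_neg ?_
      rintro ⟨h1, -⟩
      omega
  ext ⟨i, x⟩ ⟨k, y⟩
  rw [hr]
  have hl := truncShift_conjTranspose_mulVec_apply (fun ix => hankelMatrix N A ix (k, y)) i x
  have : ((truncShift κ N)ᴴ * hankelMatrix N A) (i, x) (k, y) =
      ((truncShift κ N)ᴴ *ᵥ fun ix => hankelMatrix N A ix (k, y)) (i, x) := rfl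
  rw [this, hl]
  simp only [hankelMatrix, Matrix.of_apply]
  have := i.2
  have := k.2
  split_ifs <;> first | rfl | omega | (congr 1; omega)

/-- In the reversed indices `b = N - i` and `c = N - k` the Hankel block is `A (b + c)`, present
exactly when `b + c ≤ N`. The pairing thus groups into the coefficients of degree `j = b + c` of a
product of polynomials. -/
theorem sum_mul_hankelMatrix_mul_aeval [Fintype κ] [DecidableEq κ]
    (A : ℕ → Matrix κ κ ℂ) (q : ℂ[X])
    (f h : Fin (N + 1) × κ → ℂ) :
    ∑ ix, h ix * ((hankelMatrix N A * aeval (truncShift κ N) q) *ᵥ f) ix =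
      ∑ j ∈ range (N + 1), (q * ∑ x, ∑ y, C (A j x y) *
        (revBlockPoly h x * revBlockPoly f y)).coeff j := by
  have h1 : ∀ i x, ((hankelMatrix N A * aeval (truncShift κ N) q) *ᵥ f) (i, x) =
      ∑ y, ∑ c ∈ range (N + 1), if N - (i : ℕ) + c < N + 1 then
        A (N - i + c) x y * (q * revBlockPoly f y).coeff c else 0 := by
    intro i x
    rw [← Matrix.mulVec_mulVec]
    conv_lhs => rw [Matrix.mulVec, dotProduct]
    rw [Fintype.sum_prod_type_right]
    refine Finset.sum_congr rfl fun y _ => ?_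
    rw [← sum_fin_rev]
    refine Finset.sum_congr rfl fun k _ => ?_
    rw [aeval_truncShift_mulVec_apply]
    simp only [hankelMatrix, Matrix.of_apply, ite_mul, zero_mul]
    have hi := i.2
    have hk := k.2
    have e : 2 * N - ((i : ℕ) + k) = N - i + (N - k) := by omega
    rw [e]
    split_ifs <;> first | rfl | omega
  rw [Fintype.sum_prod_type_right]
  have h2 : ∀ x, ∑ i, h (i, x) *
      ((hankelMatrix N A * aeval (truncShift κ N) q) *ᵥ f) (i, x) =
      ∑ y, ∑ j ∈ range (N + 1), A j x y * (revBlockPoly h x * (q * revBlockPoly f y)).coeff j := by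
    intro x
    calc _ = ∑ b ∈ range (N + 1), (revBlockPoly h x).coeff b * ∑ y, ∑ c ∈ range (N + 1),
          (if b + c < N + 1 then A (b + c) x y * (q * revBlockPoly f y).coeff c else 0) := by
          rw [← sum_fin_rev]
          refine Finset.sum_congr rfl fun i _ => ?_
          rw [h1, coeff_revBlockPoly]
      _ = ∑ y, ∑ b ∈ range (N + 1), ∑ c ∈ range (N + 1), (if b + c < N + 1 then
          A (b + c) x y * ((revBlockPoly h x).coeff b * (q * revBlockPoly f y).coeff c)
          else 0) := by
          simp_rw [Finset.mul_sum]
          rw [Finset.sum_comm]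
          refine Finset.sum_congr rfl fun y _ => Finset.sum_congr rfl fun b _ =>
            Finset.sum_congr rfl fun c _ => ?_
          split_ifs
          · ring
          · simp
      _ = _ := by
          refine Finset.sum_congr rfl fun y _ => ?_
          rw [sum_triangle_eq_sum_antidiagonal (N + 1) fun b c =>
            A (b + c) x y * ((revBlockPoly h x).coeff b * (q * revBlockPoly f y).coeff c)]
          refine Finset.sum_congr rfl fun j _ => ?_
          rw [coeff_mul, Finset.mul_sum]
          refine Finset.sum_congr rfl fun bc hbc => ?_
          rw [mem_antidiagonal.mp hbc]
  rw [Finset.sum_congr rfl fun x _ => h2 x]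
  have h3 : ∀ j, (q * ∑ x, ∑ y, C (A j x y) * (revBlockPoly h x * revBlockPoly f y)).coeff j =
      ∑ x, ∑ y, A j x y * (revBlockPoly h x * (q * revBlockPoly f y)).coeff j := by
    intro j
    simp_rw [Finset.mul_sum, finsetSum_coeff]
    refine Finset.sum_congr rfl fun x _ => Finset.sum_congr rfl fun y _ => ?_
    rw [← coeff_C_mul]
    congr 1
    ring
  simp_rw [h3]
  rw [Finset.sum_comm]
  simp_rw [Finset.sum_comm (s := range (N + 1)) (t := (univ : Finset κ))]
  exact Finset.sum_comm

end Blocks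

/-! ### Polynomial bound and nilpotency of the Foguel–Hankel matrix. -/

section PolynomialBound

variable {N : ℕ}

theorem sum_sq_hankel_aeval_deriv_le {κ : Type*} [Fintype κ] [DecidableEq κ] {α : ℕ → ℂ}
    (hα : ∀ m ≤ N, ((m : ℝ) + 1) ^ 2 * ∑ j ∈ Icc m N, ‖α j‖ ^ 2 ≤ 1)
    {A : ℕ → Matrix κ κ ℂ}
    (hA : ∀ a b : κ → ℂ, ∑ j ∈ range (N + 1), ‖∑ x, ∑ y, A j x y * (b x * a y)‖ ^ 2 ≤
      (∑ x, ‖a x‖ ^ 2) * ∑ x, ‖b x‖ ^ 2)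
    {p : ℂ[X]} {P : ℝ} (hp : ∀ z : ℂ, ‖z‖ = 1 → ‖p.eval z‖ ≤ P)
    (f : Fin (N + 1) × κ → ℂ) :
    ∑ ix, ‖((hankelMatrix N (fun j => α j • A j) * aeval (truncShift κ N) (derivative p)) *ᵥ f)
      ix‖ ^ 2 ≤ 4 * P ^ 2 * ∑ ix, ‖f ix‖ ^ 2 := by
  have hP : 0 ≤ P := (norm_nonneg _).trans (hp 1 (by simp))
  set g := (hankelMatrix N (fun j => α j • A j) *
    aeval (truncShift κ N) (derivative p)) *ᵥ f with hg
  -- Testing `g` against its own conjugate yields `‖g‖² ≤ 2P ‖f‖ ‖g‖`.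
  have h1 := sum_mul_hankelMatrix_mul_aeval (fun j => α j • A j) (derivative p) f (star g)
  rw [← hg] at h1
  have h2 := norm_sum_coeff_deriv_bilin_le hα hA hp (revBlockPoly f) (revBlockPoly (star g))
  have h3 : ∑ j ∈ range (N + 1), α j * (derivative p * ∑ x, ∑ y, C (A j x y) *
      (revBlockPoly (star g) x * revBlockPoly f y)).coeff j = ∑ ix, star g ix * g ix := by
    rw [h1]
    refine Finset.sum_congr rfl fun j _ => ?_
    rw [← coeff_C_mul]
    congr 1
    simp only [Matrix.smul_apply, smul_eq_mul, map_mul, Finset.mul_sum]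
    refine Finset.sum_congr rfl fun x _ => Finset.sum_congr rfl fun y _ => ?_
    ring
  have h4 : ∑ ix, star g ix * g ix = ((∑ ix, ‖g ix‖ ^ 2 : ℝ) : ℂ) := star_dotProduct_self_eq g
  rw [h3, h4, sum_hardySq_revBlockPoly, sum_hardySq_revBlockPoly, Complex.norm_real,
    Real.norm_eq_abs] at h2
  simp only [Pi.star_apply, norm_star] at h2
  set G := ∑ ix, ‖g ix‖ ^ 2
  set F := ∑ ix, ‖f ix‖ ^ 2
  have hG : 0 ≤ G := Finset.sum_nonneg fun _ _ => by positivity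
  have hF : 0 ≤ F := Finset.sum_nonneg fun _ _ => by positivity
  rw [abs_of_nonneg hG] at h2
  have hGs : √G * √G = G := Real.mul_self_sqrt hG
  have hFs : √F * √F = F := Real.mul_self_sqrt hF
  rcases (Real.sqrt_nonneg G).eq_or_lt with h | h
  · have hG0 : G = 0 := by rw [← hGs, ← h, mul_zero]
    rw [hG0]
    positivity
  · have h5 : √G ≤ 2 * P * √F := by
      refine le_of_mul_le_mul_right ?_ h
      calc √G * √G = G := hGs
        _ ≤ _ := h2
        _ = _ := by ring
    calc G = √G * √G := hGs.symm
      _ ≤ (2 * P * √F) * (2 * P * √F) := by gcongr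
      _ = 4 * P ^ 2 * (√F * √F) := by ring
      _ = _ := by rw [hFs]

theorem aeval_pisierMatrix (α : ℕ → ℂ) (p : ℂ[X]) :
    aeval (pisierMatrix N α) p = fromBlocks (aeval (truncShift (Fin (N + 1) → Fin 2) N)ᴴ p)
      (hankelMatrix N (fun j => α j • carMatrix N j) *
        aeval (truncShift (Fin (N + 1) → Fin 2) N) (derivative p)) 0
      (aeval (truncShift (Fin (N + 1) → Fin 2) N) p) :=
  aeval_fromBlocks_intertwined (truncShift_conjTranspose_mul_hankelMatrix _) p

theorem norm_aeval_pisierMatrix_le {α : ℕ → ℂ}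
    (hα : ∀ m ≤ N, ((m : ℝ) + 1) ^ 2 * ∑ j ∈ Icc m N, ‖α j‖ ^ 2 ≤ 1)
    {p : ℂ[X]} {P : ℝ} (hp : ∀ z : ℂ, ‖z‖ = 1 → ‖p.eval z‖ ≤ P) :
    ‖aeval (toEuclideanCLM (n := FHIndex N) (𝕜 := ℂ) (pisierMatrix N α)) p‖ ≤ 3 * P := by
  have hP : 0 ≤ P := (norm_nonneg _).trans (hp 1 (by simp))
  have e : aeval (toEuclideanCLM (n := FHIndex N) (𝕜 := ℂ) (pisierMatrix N α)) p =
      toEuclideanCLM (n := FHIndex N) (𝕜 := ℂ) (aeval (pisierMatrix N α) p) :=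
    aeval_algHom_apply (toEuclideanCLM (n := FHIndex N) (𝕜 := ℂ)).toAlgEquiv.toAlgHom _ p
  rw [e]
  refine ContinuousLinearMap.opNorm_le_bound _ (by positivity) fun F => ?_
  obtain ⟨F, rfl⟩ := (WithLp.toLp_surjective 2) F
  rw [toEuclideanCLM_toLp]
  refine le_of_sq_le_sq ?_ (by positivity)
  rw [mul_pow, EuclideanSpace.norm_sq_eq, EuclideanSpace.norm_sq_eq]
  simp only []
  rw [aeval_pisierMatrix, Matrix.fromBlocks_mulVec, Fintype.sum_sum_type, Fintype.sum_sum_type]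
  simp only [Sum.elim_inl, Sum.elim_inr, Matrix.zero_mulVec, zero_add]
  have h1 := sum_sq_aeval_truncShift_conjTranspose_le hp (F ∘ Sum.inl)
  have h2 := sum_sq_hankel_aeval_deriv_le hα sum_sq_carMatrix_bilin_le hp (F ∘ Sum.inr)
  have h3 := sum_sq_aeval_truncShift_le hp (F ∘ Sum.inr)
  -- The upper row contributes at most `2P²‖F₁‖² + 8P²‖F₂‖²` and the lower row `P²‖F₂‖²`, in total
  -- at most `(3P)²‖F‖²`.
  have h4 : ∀ a b : Fin (N + 1) × (Fin (N + 1) → Fin 2) → ℂ,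
      ∑ i, ‖(a + b) i‖ ^ 2 ≤ 2 * ∑ i, ‖a i‖ ^ 2 + 2 * ∑ i, ‖b i‖ ^ 2 := by
    intro a b
    rw [Finset.mul_sum, Finset.mul_sum, ← Finset.sum_add_distrib]
    refine Finset.sum_le_sum fun i _ => ?_
    have := norm_add_le (a i) (b i)
    rw [Pi.add_apply]
    nlinarith [norm_nonneg (a i + b i), sq_nonneg (‖a i‖ - ‖b i‖)]
  have h5 := h4 (aeval (truncShift (Fin (N + 1) → Fin 2) N)ᴴ p *ᵥ (F ∘ Sum.inl))
    ((hankelMatrix N (fun j => α j • carMatrix N j) *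
      aeval (truncShift (Fin (N + 1) → Fin 2) N) (derivative p)) *ᵥ (F ∘ Sum.inr))
  simp only [Function.comp_apply] at h1 h2 h3
  have hA : 0 ≤ P ^ 2 * ∑ i, ‖F (Sum.inl i)‖ ^ 2 := by positivity
  nlinarith

/-- The diagonal blocks already vanish at exponent `N + 1`; the corner contains a derivative and
needs one degree more. -/
theorem pisierMatrix_pow_eq_zero (α : ℕ → ℂ) : pisierMatrix N α ^ (N + 2) = 0 := by
  have hS : ∀ q : ℂ[X], aeval (truncShift (Fin (N + 1) → Fin 2) N) (X ^ (N + 1) * q) = 0 := by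
    intro q
    refine Matrix.ext_of_mulVec_single fun k => ?_
    funext ⟨i, x⟩
    rw [aeval_truncShift_mulVec_apply, mul_assoc, coeff_X_pow_mul', if_neg (by omega)]
    simp
  have hS' : ∀ q : ℂ[X], aeval (truncShift (Fin (N + 1) → Fin 2) N)ᴴ (X ^ (N + 1) * q) = 0 := by
    intro q
    refine Matrix.ext_of_mulVec_single fun k => ?_
    funext ⟨i, x⟩
    rw [aeval_truncShift_conjTranspose_mulVec_apply, mul_assoc, coeff_X_pow_mul',
      if_neg (by omega)]
    simp
  have h := aeval_pisierMatrix (N := N) α (X ^ (N + 2))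
  have e : derivative (X ^ (N + 2) : ℂ[X]) = X ^ (N + 1) * C ((N + 2 : ℕ) : ℂ) := by
    rw [derivative_X_pow, mul_comm]
    rfl
  rw [e, hS, show (X ^ (N + 2) : ℂ[X]) = X ^ (N + 1) * X from pow_succ _ _, hS, hS', ← pow_succ,
    map_pow, aeval_X, Matrix.mul_zero, Matrix.fromBlocks_zero] at h
  exact h

end PolynomialBound

/-! ### Perturbation of nilpotent elements -/

section Perturbation

variable {A : Type*} [NormedRing A]

/-- Exponents are split into blocks of length `m`. Beyond the first block the powers of `R` vanish
and those of `T` decay geometrically. The bound does not depend on `Q`, is continuous in `T`, and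
vanishes at `T = R`. -/
theorem sum_norm_pow_sub_pow_le {R T : A} {m : ℕ} (hR : R ^ m = 0) (hT : ‖T ^ m‖ ≤ 1 / 2) (Q : ℕ) :
    ∑ n ∈ range (m * (Q + 1)), ‖T ^ n - R ^ n‖ ≤
      ∑ n ∈ range m, ‖T ^ n - R ^ n‖ + 2 * ‖T ^ m‖ * ∑ n ∈ range m, ‖T ^ n‖ := by
  set b := ∑ n ∈ range m, ‖T ^ n‖ with hb
  have hb0 : 0 ≤ b := Finset.sum_nonneg fun _ _ => norm_nonneg _
  have hpow : ∀ Q : ℕ, ∀ r, ‖T ^ (m * (Q + 1) + r)‖ ≤ ‖T ^ m‖ ^ (Q + 1) * ‖T ^ r‖ := by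
    intro Q r
    rw [pow_add, pow_mul]
    exact (norm_mul_le _ _).trans (by gcongr; exact norm_pow_le' _ (Nat.succ_pos _))
  have key : ∑ n ∈ range (m * (Q + 1)), ‖T ^ n - R ^ n‖ ≤
      ∑ n ∈ range m, ‖T ^ n - R ^ n‖ + b * ∑ q ∈ range Q, ‖T ^ m‖ ^ (q + 1) := by
    induction Q with
    | zero => simp
    | succ Q ih =>
      rw [mul_add m (Q + 1) 1, mul_one, Finset.sum_range_add, Finset.sum_range_succ _ Q, mul_add b,
        ← add_assoc]
      refine add_le_add ih ?_
      rw [hb, Finset.sum_mul]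
      refine Finset.sum_le_sum fun r _ => ?_
      rw [pow_add R, pow_mul R, hR, zero_pow (Nat.succ_ne_zero _), zero_mul, sub_zero]
      exact (hpow Q r).trans_eq (mul_comm _ _)
  refine key.trans ?_
  have hgeom : ∑ q ∈ range Q, ‖T ^ m‖ ^ (q + 1) ≤ 2 * ‖T ^ m‖ := by
    -- Carrying a multiple of the next power makes the induction close.
    have : ∀ Q : ℕ, ∑ q ∈ range Q, ‖T ^ m‖ ^ (q + 1) + 2 * ‖T ^ m‖ ^ (Q + 1) ≤ 2 * ‖T ^ m‖ := by
      intro Q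
      induction Q with
      | zero => simp
      | succ Q ih =>
        rw [Finset.sum_range_succ]
        have h0 : 0 ≤ ‖T ^ m‖ ^ (Q + 1) := by positivity
        have : ‖T ^ m‖ ^ (Q + 1 + 1) ≤ ‖T ^ m‖ ^ (Q + 1) * (1 / 2) := by
          rw [pow_succ]
          gcongr
        linarith
    have h0 : 0 ≤ 2 * ‖T ^ m‖ ^ (Q + 1) := by positivity
    linarith [this Q]
  nlinarith

/-- A polynomial changes little on a neighbourhood of a nilpotent element, uniformly for
polynomials with coefficients bounded by `P`. -/
theorem eventually_norm_aeval_sub_le [NormedAlgebra ℂ A] {R : A} {m : ℕ} (hm : m ≠ 0)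
    (hR : R ^ m = 0) :
    ∀ᶠ T in nhds R, ∀ (p : ℂ[X]) (P : ℝ), (∀ n, ‖p.coeff n‖ ≤ P) →
      ‖aeval T p - aeval R p‖ ≤ P := by
  have hF : Continuous fun T : A => ∑ n ∈ range m, ‖T ^ n - R ^ n‖ +
      2 * ‖T ^ m‖ * ∑ n ∈ range m, ‖T ^ n‖ := by fun_prop
  have hh : Continuous fun T : A => ‖T ^ m‖ := by fun_prop
  have e1 : ∀ᶠ T in nhds R, ∑ n ∈ range m, ‖T ^ n - R ^ n‖ +
      2 * ‖T ^ m‖ * ∑ n ∈ range m, ‖T ^ n‖ < 1 :=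
    (hF.tendsto R).eventually_lt_const (by simp [hR])
  have e2 : ∀ᶠ T in nhds R, ‖T ^ m‖ < 1 / 2 :=
    (hh.tendsto R).eventually_lt_const (by simp [hR])
  filter_upwards [e1, e2] with T h1 h2 p P hp
  have hP : 0 ≤ P := (norm_nonneg _).trans (hp 0)
  have hsum := (sum_norm_pow_sub_pow_le hR h2.le p.natDegree).trans h1.le
  have hdeg : p.natDegree < m * (p.natDegree + 1) := by
    have := Nat.le_mul_of_pos_left (p.natDegree + 1) (Nat.pos_of_ne_zero hm)
    omega
  rw [aeval_eq_sum_range' hdeg, aeval_eq_sum_range' hdeg, ← Finset.sum_sub_distrib]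
  calc _ ≤ ∑ n ∈ range (m * (p.natDegree + 1)), P * ‖T ^ n - R ^ n‖ := by
        refine (norm_sum_le _ _).trans (Finset.sum_le_sum fun n _ => ?_)
        rw [← smul_sub]
        exact (norm_smul_le _ _).trans (by gcongr; exact hp n)
    _ = P * ∑ n ∈ range (m * (p.natDegree + 1)), ‖T ^ n - R ^ n‖ := by rw [Finset.mul_sum]
    _ ≤ P * 1 := by gcongr
    _ = P := mul_one P

end Perturbation

/-! ### Transfer of the polynomial bound to nearby operators. -/

theorem norm_eval_le_of_polySupNorm {p : ℂ[X]} (hp : polySupNorm p ≠ ⊤) {z : ℂ} (hz : ‖z‖ = 1) :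
    ‖p.eval z‖ ≤ (polySupNorm p).toReal := by
  have h1 : ∀ w ∈ Metric.ball (0 : ℂ) 1, ‖p.eval w‖ ≤ (polySupNorm p).toReal := by
    intro w hw
    have : ‖p.eval w‖ₑ ≤ polySupNorm p := le_iSup₂ (f := fun z _ => ‖p.eval z‖ₑ) w hw
    simpa using ENNReal.toReal_mono hp this
  have hz' : z ∈ closure (Metric.ball (0 : ℂ) 1) := by
    rw [closure_ball _ one_ne_zero]
    simp [hz]
  exact closure_minimal (t := {w | ‖p.eval w‖ ≤ (polySupNorm p).toReal}) h1
    (isClosed_le (by fun_prop) continuous_const) hz'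

theorem Mpb_le_of_norm_aeval_le {H : Type*} [NormedAddCommGroup H] [InnerProductSpace ℂ H]
    {T : H →L[ℂ] H} {M : ℝ} (hM : 0 < M)
    (h : ∀ (p : ℂ[X]) (P : ℝ), (∀ z : ℂ, ‖z‖ = 1 → ‖p.eval z‖ ≤ P) → ‖aeval T p‖ ≤ M * P) :
    Mpb T ≤ ENNReal.ofReal M := by
  refine sInf_le fun p => ?_
  rcases eq_or_ne (polySupNorm p) ⊤ with hp | hp
  · rw [hp, ENNReal.mul_top (by simpa using hM)]
    exact le_top
  · have := h p _ fun z hz => norm_eval_le_of_polySupNorm hp hz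
    rw [← ofReal_norm]
    refine (ENNReal.ofReal_le_ofReal this).trans ?_
    rw [ENNReal.ofReal_mul hM.le, ENNReal.ofReal_toReal hp]

/-- Operators close to the truncated Foguel–Hankel operator are polynomially bounded with a
universal constant. -/
theorem eventually_Mpb_le {N : ℕ} {α : ℕ → ℂ}
    (hα : ∀ m ≤ N, ((m : ℝ) + 1) ^ 2 * ∑ j ∈ Icc m N, ‖α j‖ ^ 2 ≤ 1) :
    ∀ᶠ T in nhds (toEuclideanCLM (n := FHIndex N) (𝕜 := ℂ) (pisierMatrix N α)),
      Mpb T ≤ ENNReal.ofReal 4 := by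
  have hR : toEuclideanCLM (n := FHIndex N) (𝕜 := ℂ) (pisierMatrix N α) ^ (N + 2) = 0 := by
    rw [← map_pow, pisierMatrix_pow_eq_zero, map_zero]
  filter_upwards [eventually_norm_aeval_sub_le (Nat.succ_ne_zero (N + 1)) hR] with T hT
  refine Mpb_le_of_norm_aeval_le (by norm_num) fun p P hp => ?_
  have h1 := hT p P fun n => norm_coeff_le_of_circle hp n
  have h2 := norm_aeval_pisierMatrix_le hα hp
  have h3 := norm_add_le
    (aeval T p - aeval (toEuclideanCLM (n := FHIndex N) (𝕜 := ℂ) (pisierMatrix N α)) p)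
    (aeval (toEuclideanCLM (n := FHIndex N) (𝕜 := ℂ) (pisierMatrix N α)) p)
  rw [sub_add_cancel] at h3
  linarith

/-! ### Lower bound for the complete polynomial bound. -/

section CompleteBound

variable {N : ℕ}

theorem star_carMatrix_apply (j : ℕ) (x y : Fin (N + 1) → Fin 2) :
    star (carMatrix N j x y) = carMatrix N j x y := by
  simp only [carMatrix, tensorMatrix, Matrix.of_apply, star_prod]
  refine Finset.prod_congr rfl fun l _ => ?_
  generalize x l = a
  generalize y l = b
  split_ifs <;> fin_cases a <;> fin_cases b <;> simp

theorem revBlockPoly_single_last {κ : Type*} [DecidableEq κ] (y x : κ) :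
    revBlockPoly (Pi.single (Fin.last N, y) (1 : ℂ)) x = if x = y then 1 else 0 := by
  rw [revBlockPoly, Finset.sum_eq_single (Fin.last N)]
  · split_ifs with h
    · simp [h]
    · rw [Pi.single_apply, if_neg (by simpa using h), map_zero]
  · intro k _ hk
    rw [Pi.single_apply, if_neg (by simp [hk]), map_zero]
  · simp

/-- After reversal, unit vectors in the last block are constant polynomials, so the bilinear formula
isolates the coefficients of `p'`. -/
theorem aeval_pisierMatrix_corner (α : ℕ → ℂ) (p : ℂ[X]) (x y : Fin (N + 1) → Fin 2) :
    aeval (pisierMatrix N α) p (Sum.inl (Fin.last N, x)) (Sum.inr (Fin.last N, y)) =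
      ∑ j ∈ range (N + 1), p.coeff (j + 1) * (j + 1) * (α j * carMatrix N j x y) := by
  have h := sum_mul_hankelMatrix_mul_aeval (fun j => α j • carMatrix N j) (derivative p)
    (Pi.single (Fin.last N, y) 1) (Pi.single (Fin.last N, x) 1)
  rw [Finset.sum_eq_single (Fin.last N, x) (fun i _ hi => by simp [hi]) (by simp)] at h
  rw [aeval_pisierMatrix, Matrix.fromBlocks_apply₁₂]
  simp only [Matrix.mulVec_single_one, Matrix.col_apply, Pi.single_eq_same, one_mul] at h
  rw [h]
  refine Finset.sum_congr rfl fun j _ => ?_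
  simp only [revBlockPoly_single_last, mul_ite, mul_one, mul_zero,
    Finset.sum_ite_eq', mem_univ, if_true, coeff_mul_C, coeff_derivative,
    Matrix.smul_apply, smul_eq_mul]

/-- The matrix of polynomials `∑ (j + 1) conj(α_j) z ^ (j + 1) C_{Nj}`. -/
noncomputable def carPoly (N : ℕ) (α : ℕ → ℂ) (x y : Fin (N + 1) → Fin 2) : ℂ[X] :=
  ∑ j ∈ range (N + 1), C ((j + 1) * star (α j) * carMatrix N j x y) * X ^ (j + 1)

theorem coeff_carPoly (α : ℕ → ℂ) (x y : Fin (N + 1) → Fin 2) {j : ℕ} (hj : j ∈ range (N + 1)) :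
    (carPoly N α x y).coeff (j + 1) = (j + 1) * star (α j) * carMatrix N j x y := by
  rw [carPoly, finsetSum_coeff, Finset.sum_eq_single_of_mem j hj]
  · rw [coeff_C_mul, coeff_X_pow, if_pos rfl, mul_one]
  · intro i _ hij
    rw [coeff_C_mul, coeff_X_pow, if_neg (by omega), mul_zero]

/-- The conjugates in `carPoly` turn each term into `(j + 1)² |α_j|² |C_{Nj}(x, y)|²`, so nothing
cancels in the sum. -/
theorem sum_aeval_carPoly_corner (α : ℕ → ℂ) :
    ∑ x, ∑ y, aeval (pisierMatrix N α) (carPoly N α x y)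
      (Sum.inl (Fin.last N, x)) (Sum.inr (Fin.last N, y)) =
      ((2 ^ N * ∑ j ∈ range (N + 1), ((j : ℝ) + 1) ^ 2 * ‖α j‖ ^ 2 : ℝ) : ℂ) := by
  simp_rw [aeval_pisierMatrix_corner]
  calc _ = ∑ x, ∑ y, ∑ j ∈ range (N + 1), ((j : ℂ) + 1) ^ 2 * (star (α j) * α j) *
        (carMatrix N j x y * star (carMatrix N j x y)) := by
        refine Finset.sum_congr rfl fun x _ => Finset.sum_congr rfl fun y _ =>
          Finset.sum_congr rfl fun j hj => ?_
        rw [coeff_carPoly α x y hj, star_carMatrix_apply]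
        ring
    _ = ∑ j ∈ range (N + 1), ((j : ℂ) + 1) ^ 2 * (star (α j) * α j) * 2 ^ N := by
        simp_rw [Finset.sum_comm (t := range (N + 1))]
        refine Finset.sum_congr rfl fun j hj => ?_
        rw [← sum_carMatrix_sq (N := N) (j := j) (by have := mem_range.mp hj; omega)]
        simp_rw [Finset.mul_sum]
    _ = _ := by
        push_cast
        rw [Finset.mul_sum]
        refine Finset.sum_congr rfl fun j _ => ?_
        rw [RCLike.star_def, Complex.conj_mul']
        ring

theorem eval_carPoly (α : ℕ → ℂ) (z : ℂ) (x y : Fin (N + 1) → Fin 2) :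
    (carPoly N α x y).eval z = (∑ j ∈ range (N + 1),
      ((j + 1) * star (α j) * z ^ (j + 1)) • carMatrix N j) x y := by
  rw [carPoly, eval_finsetSum, Matrix.sum_apply]
  refine Finset.sum_congr rfl fun j _ => ?_
  simp only [eval_mul, eval_C, eval_pow, eval_X, Matrix.smul_apply, smul_eq_mul]
  ring

/-- `carPoly`, indexed by an initial segment of the natural numbers. -/
noncomputable def carPolyMatrix (N : ℕ) (α : ℕ → ℂ) {n : ℕ}
    (e : Fin n ≃ (Fin (N + 1) → Fin 2)) : Matrix (Fin n) (Fin n) ℂ[X] :=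
  Matrix.of fun a b => carPoly N α (e a) (e b)

theorem matPolySupNorm_carPolyMatrix_le (α : ℕ → ℂ) {n : ℕ}
    (e : Fin n ≃ (Fin (N + 1) → Fin 2)) :
    matPolySupNorm (carPolyMatrix N α e) ≤
      ENNReal.ofReal √(∑ j ∈ range (N + 1), ((j : ℝ) + 1) ^ 2 * ‖α j‖ ^ 2) := by
  refine iSup₂_le fun z hz => ?_
  have hz' : ‖z‖ ≤ 1 := by
    rw [mem_ball_zero_iff] at hz
    exact hz.le
  rw [← ofReal_norm]
  refine ENNReal.ofReal_le_ofReal ?_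
  refine ContinuousLinearMap.opNorm_le_bound _ (by positivity) fun f => ?_
  obtain ⟨f, rfl⟩ : ∃ g : Fin n → ℂ, WithLp.toLp 2 g = f := ⟨f.ofLp, rfl⟩
  rw [toEuclideanCLM_toLp]
  refine le_of_sq_le_sq ?_ (by positivity)
  have hs : 0 ≤ ∑ j ∈ range (N + 1), ((j : ℝ) + 1) ^ 2 * ‖α j‖ ^ 2 :=
    Finset.sum_nonneg fun _ _ => by positivity
  rw [mul_pow, EuclideanSpace.norm_sq_eq, EuclideanSpace.norm_sq_eq, Real.sq_sqrt hs]
  simp only []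
  have h := sum_sq_sum_carMatrix_mulVec_le (N := N)
    (fun j => (j + 1) * star (α j) * z ^ (j + 1)) (f ∘ e.symm)
  rw [← e.sum_comp, ← e.sum_comp (fun x => ‖(f ∘ e.symm) x‖ ^ 2)] at h
  have e1 : ∀ a, ((carPolyMatrix N α e).map (eval z) *ᵥ f) a = ((∑ j ∈ range (N + 1),
      ((j + 1) * star (α j) * z ^ (j + 1)) • carMatrix N j) *ᵥ (f ∘ e.symm)) (e a) := by
    intro a
    simp only [Matrix.mulVec, dotProduct]
    rw [← e.sum_comp]
    refine Finset.sum_congr rfl fun b _ => ?_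
    rw [Matrix.map_apply, carPolyMatrix, Matrix.of_apply, eval_carPoly]
    simp
  simp only [e1]
  refine h.trans ?_
  simp only [Function.comp_apply, Equiv.symm_apply_apply]
  gcongr with j
  rw [norm_mul, norm_mul, norm_star, norm_pow, mul_pow, mul_pow]
  have h1 : ‖(j : ℂ) + 1‖ = (j : ℝ) + 1 := by
    have := Complex.norm_natCast (j + 1)
    push_cast at this
    exact this
  rw [h1]
  refine mul_le_of_le_one_right (by positivity) ?_
  exact pow_le_one₀ (by positivity) (pow_le_one₀ (norm_nonneg _) hz')

/-- The tuples `v` and `w` are vectors of norm `√n` in the Hilbert sum, and the left side is one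
matrix coefficient of the block operator. -/
theorem le_norm_blockOperator {H : Type*} [NormedAddCommGroup H] [InnerProductSpace ℂ H] {n : ℕ}
    (A : Matrix (Fin n) (Fin n) (H →L[ℂ] H)) {v w : Fin n → H} (hv : ∀ i, ‖v i‖ = 1)
    (hw : ∀ i, ‖w i‖ = 1) :
    ‖∑ a, ∑ b, inner ℂ (w a) (A a b (v b))‖ ≤ n * ‖blockOperator A‖ := by
  have hn : ∀ v : Fin n → H, (∀ i, ‖v i‖ = 1) → ‖WithLp.toLp 2 v‖ = √n := by
    intro v hv
    rw [PiLp.norm_eq_of_L2]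
    simp [hv]
  have h1 : ∑ a, ∑ b, inner ℂ (w a) (A a b (v b)) =
      inner ℂ (WithLp.toLp 2 w) (blockOperator A (WithLp.toLp 2 v)) := by
    rw [PiLp.inner_apply]
    refine Finset.sum_congr rfl fun a _ => ?_
    simp [blockOperator, inner_sum]
  rw [h1]
  calc _ ≤ ‖WithLp.toLp 2 w‖ * (‖blockOperator A‖ * ‖WithLp.toLp 2 v‖) :=
        (norm_inner_le_norm _ _).trans (by gcongr; exact ContinuousLinearMap.le_opNorm _ _)
    _ = (√n * √n) * ‖blockOperator A‖ := by rw [hn v hv, hn w hw]; ring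
    _ = _ := by rw [Real.mul_self_sqrt (by positivity)]

/-- Operators close to the truncated Foguel–Hankel operator have a large complete polynomial
bound. -/
theorem eventually_le_Mcpb (α : ℕ → ℂ)
    (hα : 0 < ∑ j ∈ range (N + 1), ((j : ℝ) + 1) ^ 2 * ‖α j‖ ^ 2) :
    ∀ᶠ T in nhds (toEuclideanCLM (n := FHIndex N) (𝕜 := ℂ) (pisierMatrix N α)),
      ENNReal.ofReal (√(∑ j ∈ range (N + 1), ((j : ℝ) + 1) ^ 2 * ‖α j‖ ^ 2) / 4) ≤ Mcpb T := by
  set s := ∑ j ∈ range (N + 1), ((j : ℝ) + 1) ^ 2 * ‖α j‖ ^ 2 with hs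
  set R := toEuclideanCLM (n := FHIndex N) (𝕜 := ℂ) (pisierMatrix N α) with hR
  obtain ⟨e⟩ : Nonempty (Fin (2 ^ (N + 1)) ≃ (Fin (N + 1) → Fin 2)) :=
    ⟨(Fintype.equivFinOfCardEq (by simp)).symm⟩
  set v : Fin (2 ^ (N + 1)) → EuclideanSpace ℂ (FHIndex N) := fun b =>
    EuclideanSpace.single (Sum.inr (Fin.last N, e b)) 1
  set w : Fin (2 ^ (N + 1)) → EuclideanSpace ℂ (FHIndex N) := fun a =>
    EuclideanSpace.single (Sum.inl (Fin.last N, e a)) 1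
  set ℓ : (EuclideanSpace ℂ (FHIndex N) →L[ℂ] EuclideanSpace ℂ (FHIndex N)) → ℂ := fun T =>
    ∑ a, ∑ b, inner ℂ (w a) (aeval T (carPolyMatrix N α e a b) (v b)) with hℓ
  -- Only finitely many fixed polynomials occur, so the lower bound at `R` persists nearby up to a
  -- factor `1 / 2`.
  have hcont : Continuous fun T => ‖ℓ T‖ := by
    refine continuous_norm.comp (continuous_finsetSum _ fun a _ =>
      continuous_finsetSum _ fun b _ => ?_)
    exact continuous_const.inner ((Polynomial.continuous_aeval _).clm_apply continuous_const)
  have hval : ℓ R = ((2 ^ N * s : ℝ) : ℂ) := by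
    rw [hs, ← sum_aeval_carPoly_corner α, hℓ, ← e.sum_comp]
    refine Finset.sum_congr rfl fun a _ => ?_
    rw [← e.sum_comp]
    refine Finset.sum_congr rfl fun b _ => ?_
    have e1 : aeval R (carPolyMatrix N α e a b) = toEuclideanCLM (n := FHIndex N) (𝕜 := ℂ)
        (aeval (pisierMatrix N α) (carPolyMatrix N α e a b)) :=
      aeval_algHom_apply (toEuclideanCLM (n := FHIndex N) (𝕜 := ℂ)).toAlgEquiv.toAlgHom _ _
    rw [e1, EuclideanSpace.inner_single_left]
    simp only [v, ← PiLp.toLp_single, toEuclideanCLM_toLp, carPolyMatrix, of_apply]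
    simp
  have hlt : 2 ^ N * s / 2 < ‖ℓ R‖ := by
    rw [hval, Complex.norm_real, Real.norm_eq_abs, abs_of_pos (by positivity)]
    have : 0 < 2 ^ N * s := by positivity
    linarith
  filter_upwards [(hcont.tendsto R).eventually_const_lt hlt] with T hT
  refine le_sInf fun M hM => ?_
  have h1 := hM _ (carPolyMatrix N α e)
  have h2 := le_norm_blockOperator ((carPolyMatrix N α e).map (aeval T)) (v := v) (w := w)
    (fun i => by simp [v]) (fun i => by simp [w])
  -- The value `2^N s / 2` is divided by the `2^(N+1)` of the test vectors.
  have h3 : s / 4 ≤ ‖blockOperator ((carPolyMatrix N α e).map (aeval T))‖ := by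
    have h4 : 2 ^ N * s / 2 ≤
        ((2 ^ (N + 1) : ℕ) : ℝ) * ‖blockOperator ((carPolyMatrix N α e).map (aeval T))‖ :=
      hT.le.trans h2
    push_cast at h4
    rw [pow_succ] at h4
    have : (0 : ℝ) < 2 ^ N := by positivity
    nlinarith
  rcases eq_or_ne M ⊤ with rfl | hMt
  · exact le_top
  have h5 : ENNReal.ofReal (s / 4) ≤ M * ENNReal.ofReal √s :=
    calc _ ≤ ENNReal.ofReal ‖blockOperator ((carPolyMatrix N α e).map (aeval T))‖ :=
          ENNReal.ofReal_le_ofReal h3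
      _ = ‖blockOperator ((carPolyMatrix N α e).map (aeval T))‖ₑ := ofReal_norm _
      _ ≤ _ := h1
      _ ≤ _ := by
        gcongr
        exact matPolySupNorm_carPolyMatrix_le α e
  have hsq : 0 < √s := Real.sqrt_pos.mpr hα
  have h6 : s / 4 = √s / 4 * √s := by
    nlinarith [Real.mul_self_sqrt hα.le]
  rw [h6, ENNReal.ofReal_mul (by positivity)] at h5
  exact (ENNReal.mul_le_mul_iff_left (by simpa using hsq) ENNReal.ofReal_ne_top).mp h5

end CompleteBound

/-! ### Model operators of finite Blaschke products -/

section Model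

theorem hardyShift_apply_zero (f : HardyTwo) : hardyShift f 0 = 0 := rfl

theorem hardyShift_apply_succ (f : HardyTwo) (n : ℕ) : hardyShift f (n + 1) = f n := rfl

theorem norm_hardyShift (f : HardyTwo) : ‖hardyShift f‖ = ‖f‖ := by
  have h : ∀ g : HardyTwo, ‖g‖ ^ 2 = ∑' n, ‖g n‖ ^ 2 := by
    intro g
    have := lp.norm_rpow_eq_tsum (p := 2) (by norm_num) g
    simpa using this
  have h2 : ‖hardyShift f‖ ^ 2 = ‖f‖ ^ 2 := by
    rw [h, h]
    exact (hasSum_shiftSeq f).tsum_eq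
  exact (sq_eq_sq₀ (norm_nonneg _) (norm_nonneg _)).mp h2

/-- Evaluation at a point of the disk as a linear functional. -/
noncomputable def hardyEval (z : ℂ) (hz : ‖z‖ < 1) : HardyTwo →ₗ[ℂ] ℂ where
  toFun f := f.eval z
  map_add' u v := by
    simp only [HardyTwo.eval]
    rw [← (u.summable_eval hz).tsum_add (v.summable_eval hz)]
    simp [add_mul]
  map_smul' c u := by
    simp only [HardyTwo.eval, RingHom.id_apply, smul_eq_mul]
    rw [← tsum_mul_left]
    simp [mul_assoc]

theorem eval_hardyShift (f : HardyTwo) {z : ℂ} (hz : ‖z‖ < 1) :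
    (hardyShift f).eval z = z * f.eval z := by
  simp only [HardyTwo.eval]
  rw [((hardyShift f).summable_eval hz).tsum_eq_zero_add, ← tsum_mul_left]
  simp only [hardyShift_apply_zero, zero_mul, zero_add, hardyShift_apply_succ]
  exact tsum_congr fun n => by ring

theorem eval_aeval_hardyShift (q : ℂ[X]) (f : HardyTwo) {z : ℂ} (hz : ‖z‖ < 1) :
    (aeval hardyShift q f).eval z = q.eval z * f.eval z := by
  change hardyEval z hz _ = _ * hardyEval z hz f
  induction q using Polynomial.induction_on' with
  | add p q hp hq =>
    rw [map_add, _root_.add_apply, map_add, hp, hq, eval_add, add_mul]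
  | monomial n c =>
    have key : hardyEval z hz ((hardyShift ^ n) f) = z ^ n * hardyEval z hz f := by
      induction n with
      | zero => simp
      | succ n ih =>
        rw [pow_succ', mul_apply_eq_comp, pow_succ', mul_assoc, ← ih]
        exact eval_hardyShift _ hz
    rw [aeval_monomial, mul_apply_eq_comp, Algebra.algebraMap_eq_smul_one,
      _root_.smul_apply, one_apply_eq_self, map_smul, key, eval_monomial,
      smul_eq_mul, mul_assoc]

theorem HardyTwo.eq_zero_of_eval {f : HardyTwo} (h : ∀ z : ℂ, ‖z‖ < 1 → f.eval z = 0) : f = 0 := by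
  set p := FormalMultilinearSeries.ofScalars ℂ (fun n => f n) with hp
  have hr : (1 : ℝ≥0∞) ≤ p.radius := by
    have := p.le_radius_of_bound ‖f‖ (r := 1) fun n => by
      rw [hp, FormalMultilinearSeries.ofScalars_norm]
      simpa using lp.norm_apply_le_norm (by norm_num) f n
    simpa using this
  have hps : HasFPowerSeriesAt p.sum p 0 :=
    (p.hasFPowerSeriesOnBall (zero_lt_one.trans_le hr)).hasFPowerSeriesAt
  have hsum : ∀ z, p.sum z = f.eval z := by
    intro z
    rw [FormalMultilinearSeries.sum, HardyTwo.eval]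
    refine tsum_congr fun n => ?_
    rw [hp, FormalMultilinearSeries.ofScalars_apply_eq, smul_eq_mul]
  have hev : p.sum =ᶠ[nhds 0] fun _ => (0 : ℂ) := by
    filter_upwards [Metric.ball_mem_nhds (0 : ℂ) one_pos] with z hz
    rw [hsum, h z (by simpa using hz)]
  have h0 : p = 0 := (hps.congr hev).eq_zero
  ext n
  have h1 : p.coeff n = f n := by rw [hp, FormalMultilinearSeries.coeff_ofScalars]
  rw [← h1, h0]
  rfl

theorem HardyTwo.ext_of_eval {f g : HardyTwo} (h : ∀ z : ℂ, ‖z‖ < 1 → f.eval z = g.eval z) :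
    f = g := by
  refine sub_eq_zero.mp (HardyTwo.eq_zero_of_eval fun z hz => ?_)
  change hardyEval z hz (f - g) = 0
  rw [map_sub]
  exact sub_eq_zero.mpr (h z hz)

/-- The shift is isometric, so `S - a` is bounded below by `1 - |a|`. This gives injectivity and
closed range for products of such factors. -/
theorem le_norm_hardyShift_sub (a : ℂ) (f : HardyTwo) :
    (1 - ‖a‖) * ‖f‖ ≤ ‖aeval hardyShift (X - C a) f‖ := by
  have h : aeval hardyShift (X - C a) f = hardyShift f - a • f := by
    simp [Algebra.algebraMap_eq_smul_one]
  rw [h]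
  have := norm_sub_norm_le (hardyShift f) (a • f)
  rw [norm_hardyShift, norm_smul] at this
  linarith

theorem exists_pos_le_norm_aeval_hardyShift {s : Multiset ℂ} (hs : ∀ a ∈ s, ‖a‖ < 1) :
    ∃ c : ℝ, 0 < c ∧ ∀ f, c * ‖f‖ ≤ ‖aeval hardyShift (s.map fun a => X - C a).prod f‖ := by
  induction s using Multiset.induction_on with
  | empty => exact ⟨1, one_pos, fun f => by simp⟩
  | cons a s ih =>
    obtain ⟨c, hc, h⟩ := ih fun b hb => hs b (Multiset.mem_cons_of_mem hb)
    have ha := hs a (Multiset.mem_cons_self a s)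
    refine ⟨(1 - ‖a‖) * c, mul_pos (by linarith) hc, fun f => ?_⟩
    rw [Multiset.map_cons, Multiset.prod_cons, map_mul, mul_apply_eq_comp]
    refine le_trans ?_ (le_norm_hardyShift_sub a _)
    rw [mul_assoc]
    exact mul_le_mul_of_nonneg_left (h f) (by linarith)

theorem aeval_hardyShift_injective {s : Multiset ℂ} (hs : ∀ a ∈ s, ‖a‖ < 1) :
    Function.Injective (aeval hardyShift (s.map fun a => X - C a).prod) := by
  obtain ⟨c, hc, h⟩ := exists_pos_le_norm_aeval_hardyShift hs
  refine (injective_iff_map_eq_zero _).mpr fun f hf => ?_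
  have := h f
  rw [hf, norm_zero] at this
  exact norm_le_zero_iff.mp (by nlinarith [norm_nonneg f])

theorem isClosed_range_aeval_hardyShift {s : Multiset ℂ} (hs : ∀ a ∈ s, ‖a‖ < 1) :
    IsClosed (Set.range (aeval hardyShift (s.map fun a => X - C a).prod)) := by
  obtain ⟨c, hc, h⟩ := exists_pos_le_norm_aeval_hardyShift hs
  refine AntilipschitzWith.isClosed_range (K := c.toNNReal⁻¹) ?_
    (ContinuousLinearMap.uniformContinuous _)
  refine AddMonoidHomClass.antilipschitz_of_bound _ fun f => ?_
  rw [NNReal.coe_inv, Real.coe_toNNReal _ hc.le, inv_mul_eq_div, le_div_iff₀ hc, mul_comm]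
  exact h f

/-- The constant function `1`. -/
noncomputable def hardyOne : HardyTwo := lp.single 2 0 1

theorem eval_hardyOne (z : ℂ) : hardyOne.eval z = 1 := by
  rw [HardyTwo.eval, tsum_eq_single 0]
  · simp [hardyOne]
  · intro n hn
    rw [hardyOne, lp.single_apply_ne _ _ _ hn, zero_mul]

/-- Evaluation at `a` shows that `q` vanishes there; injectivity of `S - a` then cancels the factor,
and induction accounts for multiplicities. -/
theorem aeval_hardyShift_one_mem_range_iff {s : Multiset ℂ} (hs : ∀ a ∈ s, ‖a‖ < 1) (q : ℂ[X]) :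
    aeval hardyShift q hardyOne ∈ Set.range (aeval hardyShift (s.map fun a => X - C a).prod) ↔
      (s.map fun a => X - C a).prod ∣ q := by
  constructor
  · induction s using Multiset.induction_on generalizing q with
    | empty => simp
    | cons a s ih =>
      rintro ⟨g, hg⟩
      have ha := hs a (Multiset.mem_cons_self a s)
      have hs' : ∀ b ∈ s, ‖b‖ < 1 := fun b hb => hs b (Multiset.mem_cons_of_mem hb)
      have hroot : q.eval a = 0 := by
        have := congrArg (fun f : HardyTwo => f.eval a) hg
        simp only [eval_aeval_hardyShift _ _ ha, eval_hardyOne, mul_one] at this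
        rw [← this]
        simp
      obtain ⟨q, rfl⟩ := dvd_iff_isRoot.mpr hroot
      rw [Multiset.map_cons, Multiset.prod_cons] at hg ⊢
      refine mul_dvd_mul_left _ (ih hs' q ⟨g, ?_⟩)
      rw [map_mul, mul_apply_eq_comp, map_mul, mul_apply_eq_comp] at hg
      have hinj := aeval_hardyShift_injective (s := {a}) (by simpa using ha)
      rw [Multiset.map_singleton, Multiset.prod_singleton] at hinj
      exact hinj hg
  · rintro ⟨r, rfl⟩
    exact ⟨aeval hardyShift r hardyOne, by rw [map_mul, mul_apply_eq_comp]⟩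

theorem isUnit_one_sub_smul_hardyShift {a : ℂ} (ha : ‖a‖ < 1) :
    IsUnit (1 - a • hardyShift) := by
  refine isUnit_one_sub_of_norm_lt_one ?_
  refine lt_of_le_of_lt (ContinuousLinearMap.opNorm_smul_le a hardyShift) ?_
  have : ‖hardyShift‖ ≤ 1 :=
    ContinuousLinearMap.opNorm_le_bound _ zero_le_one fun f => by rw [norm_hardyShift, one_mul]
  nlinarith [norm_nonneg a]

/-- Each `1 - conj(a) S` is invertible by the Neumann series, so Blaschke denominators can be
divided out within `H²`. -/
theorem exists_eval_prod_one_sub_mul {s : Multiset ℂ} (hs : ∀ a ∈ s, ‖a‖ < 1) (g : HardyTwo) :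
    ∃ h : HardyTwo, ∀ z : ℂ, ‖z‖ < 1 →
      (s.map fun a => 1 - starRingEnd ℂ a * z).prod * h.eval z = g.eval z := by
  induction s using Multiset.induction_on generalizing g with
  | empty => exact ⟨g, fun z _ => by simp⟩
  | cons a s ih =>
    have ha : ‖starRingEnd ℂ a‖ < 1 := by simpa using hs a (Multiset.mem_cons_self a s)
    obtain ⟨u, hu⟩ := isUnit_one_sub_smul_hardyShift ha
    obtain ⟨h, hh⟩ := ih (fun b hb => hs b (Multiset.mem_cons_of_mem hb))
      ((↑u⁻¹ : HardyTwo →L[ℂ] HardyTwo) g)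
    refine ⟨h, fun z hz => ?_⟩
    rw [Multiset.map_cons, Multiset.prod_cons, mul_assoc, hh z hz]
    set k := (↑u⁻¹ : HardyTwo →L[ℂ] HardyTwo) g with hk
    have hgk : g = aeval hardyShift (1 - C (starRingEnd ℂ a) * X) k := by
      have e : aeval hardyShift (1 - C (starRingEnd ℂ a) * X) = (u : HardyTwo →L[ℂ] HardyTwo) := by
        rw [hu]
        simp [Algebra.algebraMap_eq_smul_one]
      rw [e, hk, ← mul_apply_eq_comp, Units.mul_inv, one_apply_eq_self]
    rw [hgk, eval_aeval_hardyShift _ _ hz]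
    simp

theorem one_sub_conj_mul_ne_zero {a z : ℂ} (ha : ‖a‖ < 1) (hz : ‖z‖ < 1) :
    1 - starRingEnd ℂ a * z ≠ 0 := by
  intro h
  have : ‖starRingEnd ℂ a * z‖ = 1 := by rw [← sub_eq_zero.mp h, norm_one]
  rw [norm_mul, RCLike.norm_conj] at this
  nlinarith [norm_nonneg a, norm_nonneg z]

theorem exists_blaschke_mul_eq {s : Multiset ℂ} (hs : ∀ a ∈ s, ‖a‖ < 1) :
    ∃ c : ℂ, c ≠ 0 ∧ ∀ z : ℂ, ‖z‖ < 1 → (s.map fun a => blaschkeFactor a z).prod *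
      (s.map fun a => 1 - starRingEnd ℂ a * z).prod =
        c * (s.map fun a => X - C a).prod.eval z := by
  induction s using Multiset.induction_on with
  | empty => exact ⟨1, one_ne_zero, fun z _ => by simp⟩
  | cons a s ih =>
    obtain ⟨c, hc, h⟩ := ih fun b hb => hs b (Multiset.mem_cons_of_mem hb)
    have ha := hs a (Multiset.mem_cons_self a s)
    obtain ⟨d, hd, hda⟩ : ∃ d : ℂ, d ≠ 0 ∧ ∀ z : ℂ, ‖z‖ < 1 →
        blaschkeFactor a z * (1 - starRingEnd ℂ a * z) = d * (z - a) := by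
      by_cases h0 : a = 0
      · exact ⟨1, one_ne_zero, fun z _ => by simp [blaschkeFactor, h0]⟩
      · refine ⟨-(‖a‖ / a), neg_ne_zero.mpr (div_ne_zero (by simpa using h0) h0), fun z hz => ?_⟩
        have := one_sub_conj_mul_ne_zero ha hz
        rw [blaschkeFactor, if_neg h0, mul_assoc, div_mul_cancel₀ _ this]
        ring
    refine ⟨d * c, mul_ne_zero hd hc, fun z hz => ?_⟩
    simp only [Multiset.map_cons, Multiset.prod_cons, eval_mul, eval_sub, eval_X, eval_C]
    linear_combination (s.map fun a => blaschkeFactor a z).prod *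
      (s.map fun a => 1 - starRingEnd ℂ a * z).prod * hda z hz + d * (z - a) * h z hz

/-- `B` and `∏ (z - a)` differ by a nonzero constant and the denominators `1 - conj(a) z`, which are
invertible multipliers of `H²`. -/
theorem mulHardy_eq_range {B : ℂ → ℂ} {s : Multiset ℂ} (hB : IsFiniteBlaschkeProduct B s) :
    (mulHardy B : Set HardyTwo) = Set.range (aeval hardyShift (s.map fun a => X - C a).prod) := by
  obtain ⟨hs, ζ, hζ, hBz⟩ := hB
  have hζ0 : ζ ≠ 0 := by
    rintro rfl
    simp at hζ
  obtain ⟨c, hc, hcz⟩ := exists_blaschke_mul_eq hs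
  ext f
  constructor
  · rintro ⟨g, hg⟩
    obtain ⟨h, hh⟩ := exists_eval_prod_one_sub_mul hs g
    refine ⟨(ζ * c) • h, HardyTwo.ext_of_eval fun z hz => ?_⟩
    have hz' : z ∈ Metric.ball (0 : ℂ) 1 := by simpa using hz
    rw [hg z hz', hBz z hz', eval_aeval_hardyShift _ _ hz, ← hh z hz]
    have : ((ζ * c) • h).eval z = ζ * c * h.eval z := (hardyEval z hz).map_smul _ _
    rw [this]
    linear_combination -ζ * h.eval z * hcz z hz
  · rintro ⟨g, rfl⟩
    refine ⟨aeval hardyShift (C (ζ * c)⁻¹ * (s.map fun a => 1 - C (starRingEnd ℂ a) * X).prod) g,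
      fun z hz => ?_⟩
    have hz' : ‖z‖ < 1 := by simpa using hz
    have e : (s.map fun a => 1 - C (starRingEnd ℂ a) * X).prod.eval z =
        (s.map fun a => 1 - starRingEnd ℂ a * z).prod := by
      rw [eval_multiset_prod, Multiset.map_map]
      simp
    rw [eval_aeval_hardyShift _ _ hz', eval_aeval_hardyShift _ _ hz', hBz z hz, eval_mul, eval_C, e]
    have h2 := hcz z hz'
    field_simp
    linear_combination -h2 * g.eval z

theorem mulHardy_orthogonal_orthogonal {B : ℂ → ℂ} {s : Multiset ℂ}
    (hB : IsFiniteBlaschkeProduct B s) : (modelSpace B)ᗮ = mulHardy B := by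
  rw [Submodule.orthogonal_orthogonal_eq_closure]
  refine IsClosed.submodule_topologicalClosure_eq ?_
  rw [mulHardy_eq_range hB]
  exact isClosed_range_aeval_hardyShift hB.1

/-- The map `q ↦ P_{K_B} q` on polynomials. -/
noncomputable def modelMap (B : ℂ → ℂ) : ℂ[X] →ₗ[ℂ] modelSpace B :=
  ((modelSpace B).orthogonalProjectionOnto : HardyTwo →ₗ[ℂ] modelSpace B) ∘ₗ
    (ContinuousLinearMap.apply ℂ HardyTwo hardyOne : _ →ₗ[ℂ] HardyTwo) ∘ₗ
    (aeval hardyShift).toLinearMap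

theorem modelMap_apply (B : ℂ → ℂ) (q : ℂ[X]) :
    modelMap B q = (modelSpace B).orthogonalProjectionOnto (aeval hardyShift q hardyOne) := rfl

theorem modelMap_eq_zero_iff {B : ℂ → ℂ} {s : Multiset ℂ} (hB : IsFiniteBlaschkeProduct B s)
    (q : ℂ[X]) : modelMap B q = 0 ↔ (s.map fun a => X - C a).prod ∣ q := by
  rw [modelMap_apply, Submodule.orthogonalProjectionOnto_eq_zero_iff,
    mulHardy_orthogonal_orthogonal hB, ← SetLike.mem_coe, mulHardy_eq_range hB,
    aeval_hardyShift_one_mem_range_iff hB.1]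

/-- `BH²` is shift invariant, so replacing `q` by its projection before the shift changes the result
only by an element of `BH²`. -/
theorem modelMap_X_mul {B : ℂ → ℂ} {s : Multiset ℂ} (hB : IsFiniteBlaschkeProduct B s)
    (q : ℂ[X]) : modelMap B (X * q) = modelOperator B (modelMap B q) := by
  have h1 : modelOperator B (modelMap B q) = (modelSpace B).orthogonalProjectionOnto
      (hardyShift (modelMap B q : HardyTwo)) := rfl
  rw [h1, modelMap_apply, map_mul, aeval_X, mul_apply_eq_comp, ← sub_eq_zero,
    ← map_sub, ← map_sub, Submodule.orthogonalProjectionOnto_eq_zero_iff,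
    mulHardy_orthogonal_orthogonal hB, ← SetLike.mem_coe, mulHardy_eq_range hB]
  have h2 : aeval hardyShift q hardyOne - (modelMap B q : HardyTwo) ∈
      Set.range (aeval hardyShift (s.map fun a => X - C a).prod) := by
    rw [← mulHardy_eq_range hB, SetLike.mem_coe, ← mulHardy_orthogonal_orthogonal hB,
      modelMap_apply]
    exact Submodule.sub_starProjection_mem_orthogonal _
  obtain ⟨g, hg⟩ := h2
  refine ⟨hardyShift g, ?_⟩
  rw [← hg, ← mul_apply_eq_comp, ← mul_apply_eq_comp]
  congr 1
  have h3 : aeval hardyShift ((s.map fun a => X - C a).prod * X) =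
      aeval hardyShift (X * (s.map fun a => X - C a).prod) := by rw [mul_comm]
  simpa only [map_mul, aeval_X] using h3

theorem dense_range_polynomial_hardy :
    Dense (Set.range fun q : ℂ[X] => aeval hardyShift q hardyOne) := by
  have hpow : ∀ n : ℕ, (hardyShift ^ n) hardyOne = lp.single 2 n 1 := by
    intro n
    induction n with
    | zero => rfl
    | succ n ih =>
      rw [pow_succ', mul_apply_eq_comp, ih]
      ext k
      cases k with
      | zero => rw [hardyShift_apply_zero, lp.single_apply_ne _ _ _ (Nat.succ_ne_zero n).symm]
      | succ k =>
        rw [hardyShift_apply_succ]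
        by_cases h : k = n
        · subst h
          rw [lp.single_apply_self, lp.single_apply_self]
        · rw [lp.single_apply_ne _ _ _ h, lp.single_apply_ne _ _ _ (by omega)]
  intro f
  refine mem_closure_of_tendsto (lp.hasSum_single (by norm_num) f)
    (Filter.Eventually.of_forall fun t => ⟨∑ i ∈ t, monomial i (f i), ?_⟩)
  simp only [map_sum, aeval_monomial, Algebra.algebraMap_eq_smul_one, smul_mul_assoc, one_mul]
  rw [_root_.sum_apply]
  refine Finset.sum_congr rfl fun i _ => ?_
  rw [_root_.smul_apply, hpow, ← lp.single_smul, smul_eq_mul, mul_one]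

theorem finiteDimensional_range_of_ker {H : Type*} [AddCommGroup H] [Module ℂ H]
    {Φ : ℂ[X] →ₗ[ℂ] H} {χ : ℂ[X]} (hχ : χ.Monic) (h : ∀ q, Φ q = 0 ↔ χ ∣ q) :
    FiniteDimensional ℂ (LinearMap.range Φ) ∧
      Module.finrank ℂ (LinearMap.range Φ) = χ.natDegree := by
  have hker : LinearMap.ker Φ = (Ideal.span {χ}).restrictScalars ℂ := by
    ext q
    rw [LinearMap.mem_ker, h, Submodule.restrictScalars_mem, Ideal.mem_span_singleton]
  have e : (ℂ[X] ⧸ Ideal.span {χ}) ≃ₗ[ℂ] LinearMap.range Φ :=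
    (Submodule.Quotient.restrictScalarsEquiv ℂ (Ideal.span {χ})).symm ≪≫ₗ
      (Submodule.quotEquivOfEq _ _ hker).symm ≪≫ₗ Φ.quotKerEquivRange
  have : Module.Finite ℂ (ℂ[X] ⧸ Ideal.span {χ}) := hχ.finite_quotient
  exact ⟨Module.Finite.equiv e, by rw [← e.finrank_eq, finrank_quotient_span_eq_natDegree]⟩

/-- The range is dense because polynomials are dense in `H²`, and closed because it is isomorphic to
the finite-dimensional `ℂ[X] / (χ)`. -/
theorem modelMap_surjective {B : ℂ → ℂ} {s : Multiset ℂ} (hB : IsFiniteBlaschkeProduct B s) :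
    Function.Surjective (modelMap B) := by
  have hfin := (finiteDimensional_range_of_ker (monic_multiset_prod_of_monic s _
    fun a _ => monic_X_sub_C a) (modelMap_eq_zero_iff hB)).1
  have hcl : IsClosed (LinearMap.range (modelMap B) : Set (modelSpace B)) :=
    Submodule.closed_of_finiteDimensional _
  have hsurj : Function.Surjective (modelSpace B).orthogonalProjectionOnto := fun x =>
    ⟨x, Submodule.orthogonalProjectionOnto_mem_subspace_eq_self x⟩
  have hd : Dense (LinearMap.range (modelMap B) : Set (modelSpace B)) := by
    have := hsurj.denseRange.dense_image
      (modelSpace B).orthogonalProjectionOnto.continuous dense_range_polynomial_hardy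
    rw [← Set.range_comp] at this
    exact this
  rw [← LinearMap.range_eq_top]
  refine SetLike.ext' ?_
  rw [← hcl.closure_eq, hd.closure_eq]
  rfl

/-- An operator with a vector whose annihilator is generated by the polynomial with the zeros of
`B` is similar to the model operator. -/
theorem similarOp_modelOperator {H : Type*} [NormedAddCommGroup H] [InnerProductSpace ℂ H]
    [FiniteDimensional ℂ H] {T : H →L[ℂ] H} {B : ℂ → ℂ} {s : Multiset ℂ}
    (hB : IsFiniteBlaschkeProduct B s) (hdim : Module.finrank ℂ H = s.card) {v : H}
    (hv : ∀ q : ℂ[X], aeval T q v = 0 → (s.map fun a => X - C a).prod ∣ q)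
    (hT : aeval T (s.map fun a => X - C a).prod v = 0) :
    SimilarOp T (modelOperator B) := by
  set χ := (s.map fun a => X - C a).prod with hχ
  have hmonic : χ.Monic := monic_multiset_prod_of_monic s _ fun a _ => monic_X_sub_C a
  let Φ : ℂ[X] →ₗ[ℂ] H := (ContinuousLinearMap.apply ℂ H v : _ →ₗ[ℂ] H) ∘ₗ (aeval T).toLinearMap
  have hΦ : ∀ q, Φ q = aeval T q v := fun q => rfl
  have hker : ∀ q, Φ q = 0 ↔ χ ∣ q := by
    intro q
    refine ⟨fun h => hv q h, ?_⟩
    rintro ⟨r, rfl⟩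
    rw [hΦ, mul_comm, map_mul, mul_apply_eq_comp, hT, map_zero]
  have hsurj : Function.Surjective Φ := by
    rw [← LinearMap.range_eq_top]
    refine Submodule.eq_top_of_finrank_eq ?_
    rw [(finiteDimensional_range_of_ker hmonic hker).2, hdim, hχ,
      natDegree_multiset_prod_X_sub_C_eq_card]
  -- Both `Φ` and `modelMap B` are surjections from `ℂ[X]` that turn multiplication by `X` into the
  -- operator; equal kernels identify the two targets.
  have hkk : LinearMap.ker Φ = LinearMap.ker (modelMap B) := by
    ext q
    rw [LinearMap.mem_ker, LinearMap.mem_ker, hker, modelMap_eq_zero_iff hB]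
  let e : H ≃ₗ[ℂ] modelSpace B := (Φ.quotKerEquivOfSurjective hsurj).symm ≪≫ₗ
    Submodule.quotEquivOfEq _ _ hkk ≪≫ₗ
    (modelMap B).quotKerEquivOfSurjective (modelMap_surjective hB)
  have he : ∀ q, e (Φ q) = modelMap B q := by
    intro q
    have : (Φ.quotKerEquivOfSurjective hsurj).symm (Φ q) = Submodule.Quotient.mk q := by
      rw [LinearEquiv.symm_apply_eq]
      rfl
    simp only [e, LinearEquiv.trans_apply, this]
    rfl
  refine ⟨e.toContinuousLinearEquiv, fun x => ?_⟩
  obtain ⟨q, rfl⟩ := hsurj x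
  have h1 : T (Φ q) = Φ (X * q) := by
    rw [hΦ, hΦ, map_mul, aeval_X, mul_apply_eq_comp]
  rw [LinearEquiv.coe_toContinuousLinearEquiv', h1, he, he, modelMap_X_mul hB]

end Model

/-! ### Cyclicity of the perturbed operators -/

section Cyclic

variable {κ : Type*} [Fintype κ] {N : ℕ}

theorem diagonal_snd_mulVec_apply [DecidableEq κ] (ν : κ → ℂ) (g : Fin (N + 1) × κ → ℂ)
    (i : Fin (N + 1)) (x : κ) :
    ((diagonal fun ix : Fin (N + 1) × κ => ν ix.2) *ᵥ g) (i, x) = ν x * g (i, x) := by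
  rw [Matrix.mulVec_diagonal]

/-- If `A` acts as multiplication by `X + r`, then `q(A)` acts as multiplication by `q(X + r)`,
which is `taylor r q`. Vanishing to order `N + 1` at the eigenvalue `r` becomes vanishing of its
first coefficients. -/
theorem aeval_mulVec_of_pow {σ : Type*} [Fintype σ] [DecidableEq σ] (A : Matrix σ σ ℂ)
    (g : σ → ℂ) (i : σ) (r : ℂ) (u : ℂ[X]) (k : ℕ)
    (h : ∀ n : ℕ, (A ^ n *ᵥ g) i = ((X + C r) ^ n * u).coeff k) (q : ℂ[X]) :
    (aeval A q *ᵥ g) i = (taylor r q * u).coeff k := by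
  induction q using Polynomial.induction_on' with
  | add p q hp hq =>
    rw [map_add, Matrix.add_mulVec, Pi.add_apply, hp, hq, map_add, add_mul, coeff_add]
  | monomial n c =>
    rw [← C_mul_X_pow_eq_monomial, map_mul, aeval_C, map_pow, aeval_X,
      Algebra.algebraMap_eq_smul_one, smul_mul_assoc, one_mul, Matrix.smul_mulVec, Pi.smul_apply,
      h, taylor_mul, taylor_C, taylor_X_pow, mul_assoc, coeff_C_mul, smul_eq_mul]

theorem aeval_truncShift_conjTranspose_add_diagonal [DecidableEq κ] (ν : κ → ℂ) (q : ℂ[X])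
    (g : Fin (N + 1) × κ → ℂ) (i : Fin (N + 1)) (x : κ) :
    (aeval ((truncShift κ N)ᴴ + diagonal fun ix => ν ix.2) q *ᵥ g) (i, x) =
      (taylor (ν x) q * blockPoly g x).coeff i := by
  refine aeval_mulVec_of_pow _ _ _ _ _ _ (fun n => ?_) q
  induction n generalizing i with
  | zero => simp [coeff_blockPoly]
  | succ n ih =>
    rw [pow_succ', ← Matrix.mulVec_mulVec, Matrix.add_mulVec, Pi.add_apply,
      truncShift_conjTranspose_mulVec_apply, diagonal_snd_mulVec_apply, ih, pow_succ', mul_assoc,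
      add_mul, coeff_add, coeff_C_mul]
    congr 1
    split_ifs with h
    · have e : (i : ℕ) = ((i : ℕ) - 1) + 1 := by omega
      rw [ih]
      conv_rhs => rw [e, coeff_X_mul]
    · have e : (i : ℕ) = 0 := by omega
      rw [e, mul_coeff_zero, coeff_X_zero, zero_mul]

theorem aeval_truncShift_add_diagonal [DecidableEq κ] (μ : κ → ℂ) (q : ℂ[X])
    (g : Fin (N + 1) × κ → ℂ) (i : Fin (N + 1)) (x : κ) :
    (aeval (truncShift κ N + diagonal fun ix => μ ix.2) q *ᵥ g) (i, x) =
      (taylor (μ x) q * revBlockPoly g x).coeff (N - i) := by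
  refine aeval_mulVec_of_pow _ _ _ _ _ _ (fun n => ?_) q
  induction n generalizing i with
  | zero => simp [coeff_revBlockPoly]
  | succ n ih =>
    rw [pow_succ', ← Matrix.mulVec_mulVec, Matrix.add_mulVec, Pi.add_apply,
      truncShift_mulVec_apply, diagonal_snd_mulVec_apply, ih, pow_succ', mul_assoc,
      add_mul, coeff_add, coeff_C_mul]
    congr 1
    split_ifs with h
    · have e : N - (i : ℕ) = (N - ((i : ℕ) + 1)) + 1 := by omega
      rw [ih, e, coeff_X_mul]
    · have e : N - (i : ℕ) = 0 := by omega
      rw [e, mul_coeff_zero, coeff_X_zero, zero_mul]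

theorem X_sub_C_pow_dvd_iff_taylor (r : ℂ) (n : ℕ) (q : ℂ[X]) :
    (X - C r) ^ n ∣ q ↔ ∀ d < n, (taylor r q).coeff d = 0 := by
  rw [X_sub_C_pow_dvd_iff, X_pow_dvd_iff]
  rfl

theorem coeff_mul_eq_zero_of_lt {f g : ℂ[X]} {n : ℕ} (h : ∀ d < n, f.coeff d = 0) {d : ℕ}
    (hd : d < n) : (f * g).coeff d = 0 := by
  rw [coeff_mul]
  refine Finset.sum_eq_zero fun x hx => ?_
  rw [h x.1 (by have := mem_antidiagonal.mp hx; omega), zero_mul]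

theorem prod_X_sub_C_pow_dvd {ν : κ → ℂ} (hν : Function.Injective ν) {n : ℕ} {q : ℂ[X]}
    (h : ∀ x, (X - C (ν x)) ^ n ∣ q) : (∏ x, (X - C (ν x))) ^ n ∣ q := by
  rw [← Finset.prod_pow]
  refine Finset.prod_dvd_of_coprime (fun x _ y _ hxy => ?_) fun x _ => h x
  exact (pairwise_coprime_X_sub_C hν hxy).pow

theorem exists_aeval_fromBlocks {σ : Type*} [Fintype σ] [DecidableEq σ] (A G D : Matrix σ σ ℂ)
    (q : ℂ[X]) : ∃ Y, aeval (fromBlocks A G 0 D) q = fromBlocks (aeval A q) Y 0 (aeval D q) := by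
  induction q using Polynomial.induction_on with
  | C c =>
    refine ⟨0, ?_⟩
    simp only [aeval_C, Algebra.algebraMap_eq_smul_one]
    rw [← Matrix.fromBlocks_one, Matrix.fromBlocks_smul]
    simp
  | add p q hp hq =>
    obtain ⟨Y, hY⟩ := hp
    obtain ⟨Z, hZ⟩ := hq
    exact ⟨Y + Z, by simp [hY, hZ, Matrix.fromBlocks_add]⟩
  | monomial n c ih =>
    obtain ⟨Y, hY⟩ := ih
    refine ⟨aeval A (C c * X ^ n) * G + Y * D, ?_⟩
    rw [pow_succ, ← mul_assoc, map_mul, hY, aeval_X, Matrix.fromBlocks_multiply,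
      map_mul (aeval A) (C c * X ^ n) X, map_mul (aeval D) (C c * X ^ n) X, aeval_X, aeval_X]
    simp

/-- A cyclic vector of a block triangular matrix whose diagonal blocks are direct sums of Jordan
blocks with distinct eigenvalues. -/
theorem exists_cyclic_vector [DecidableEq κ] {ν μ : κ → ℂ} (hν : Function.Injective ν)
    (hμ : Function.Injective μ) (hνμ : ∀ x y, ν x ≠ μ y)
    (G : Matrix (Fin (N + 1) × κ) (Fin (N + 1) × κ) ℂ) :
    ∃ v, (∀ q : ℂ[X], aeval (fromBlocks ((truncShift κ N)ᴴ + diagonal fun ix => ν ix.2) G 0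
        (truncShift κ N + diagonal fun ix => μ ix.2)) q *ᵥ v = 0 →
        (∏ x, (X - C (ν x))) ^ (N + 1) * (∏ x, (X - C (μ x))) ^ (N + 1) ∣ q) ∧
      aeval (fromBlocks ((truncShift κ N)ᴴ + diagonal fun ix => ν ix.2) G 0
        (truncShift κ N + diagonal fun ix => μ ix.2))
        ((∏ x, (X - C (ν x))) ^ (N + 1) * (∏ x, (X - C (μ x))) ^ (N + 1)) *ᵥ v = 0 := by
  set A := (truncShift κ N)ᴴ + diagonal fun ix : Fin (N + 1) × κ => ν ix.2 with hA
  set D := truncShift κ N + diagonal fun ix : Fin (N + 1) × κ => μ ix.2 with hD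
  set χ₁ : ℂ[X] := (∏ x, (X - C (ν x))) ^ (N + 1) with hχ₁
  set χ₂ : ℂ[X] := (∏ x, (X - C (μ x))) ^ (N + 1) with hχ₂
  -- These vectors have all their block polynomials equal to `1`, so each generates every Jordan
  -- block of its diagonal part.
  set v₁ : Fin (N + 1) × κ → ℂ := fun ix => if ix.1 = 0 then 1 else 0 with hv₁
  set v₂ : Fin (N + 1) × κ → ℂ := fun ix => if ix.1 = Fin.last N then 1 else 0 with hv₂
  have hb₁ : ∀ x, blockPoly v₁ x = 1 := by
    intro x
    rw [blockPoly, Finset.sum_eq_single 0 (fun k _ hk => by simp [hv₁, hk]) (by simp)]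
    simp [hv₁]
  have hb₂ : ∀ x, revBlockPoly v₂ x = 1 := by
    intro x
    rw [revBlockPoly, Finset.sum_eq_single (Fin.last N) (fun k _ hk => by simp [hv₂, hk]) (by simp)]
    simp [hv₂]
  have hdvd : ∀ (ρ : κ → ℂ) x, (X - C (ρ x)) ^ (N + 1) ∣ (∏ x, (X - C (ρ x))) ^ (N + 1) :=
    fun ρ x => pow_dvd_pow_of_dvd (Finset.dvd_prod_of_mem (fun x => X - C (ρ x)) (mem_univ x)) _
  have hAχ : ∀ g, aeval A χ₁ *ᵥ g = 0 := by
    intro g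
    funext ⟨i, x⟩
    rw [aeval_truncShift_conjTranspose_add_diagonal]
    exact coeff_mul_eq_zero_of_lt ((X_sub_C_pow_dvd_iff_taylor _ _ _).mp (hdvd ν x)) i.2
  have hDχ : ∀ g, aeval D χ₂ *ᵥ g = 0 := by
    intro g
    funext ⟨i, x⟩
    rw [aeval_truncShift_add_diagonal]
    exact coeff_mul_eq_zero_of_lt ((X_sub_C_pow_dvd_iff_taylor _ _ _).mp (hdvd μ x)) (by omega)
  have hA₁ : ∀ q, aeval A q *ᵥ v₁ = 0 → χ₁ ∣ q := by
    intro q hq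
    refine prod_X_sub_C_pow_dvd hν fun x => (X_sub_C_pow_dvd_iff_taylor _ _ _).mpr fun d hd => ?_
    have := congrFun hq (⟨d, hd⟩, x)
    rwa [aeval_truncShift_conjTranspose_add_diagonal, hb₁, mul_one] at this
  have hD₂ : ∀ q, aeval D q *ᵥ v₂ = 0 → χ₂ ∣ q := by
    intro q hq
    refine prod_X_sub_C_pow_dvd hμ fun x => (X_sub_C_pow_dvd_iff_taylor _ _ _).mpr fun d hd => ?_
    have := congrFun hq (⟨N - d, by omega⟩, x)
    rw [aeval_truncShift_add_diagonal, hb₂, mul_one] at this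
    have e : N - (N - d) = d := by omega
    simpa only [e, Pi.zero_apply] using this
  have hcop : IsCoprime χ₁ χ₂ := by
    refine IsCoprime.pow (IsCoprime.prod_left fun x _ => IsCoprime.prod_right fun y _ => ?_)
    exact isCoprime_X_sub_C_of_isUnit_sub (sub_ne_zero.mpr (hνμ x y)).isUnit
  obtain ⟨a, b, hab⟩ := hcop
  obtain ⟨Y, hY⟩ := exists_aeval_fromBlocks A G D χ₂
  -- By the Bézout identity `b(A)` inverts `χ₂(A)`, and `y₁` is chosen so that `χ₂` of the block
  -- matrix maps `(y₁, v₂)` to `(v₁, 0)`.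
  set y₁ := aeval A b *ᵥ (v₁ - Y *ᵥ v₂) with hy₁
  have hinv : ∀ w, aeval A χ₂ *ᵥ (aeval A b *ᵥ w) = w := by
    intro w
    have h1 : aeval A (a * χ₁ + b * χ₂) *ᵥ w = w := by rw [hab, map_one, Matrix.one_mulVec]
    rw [map_add, Matrix.add_mulVec, map_mul, ← Matrix.mulVec_mulVec, hAχ, Matrix.mulVec_zero,
      zero_add, mul_comm b, map_mul, ← Matrix.mulVec_mulVec] at h1
    exact h1
  have hstep : aeval (fromBlocks A G 0 D) χ₂ *ᵥ Sum.elim y₁ v₂ = Sum.elim v₁ 0 := by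
    rw [hY, Matrix.fromBlocks_mulVec]
    simp only [Sum.elim_comp_inl, Sum.elim_comp_inr, hDχ, Matrix.zero_mulVec, add_zero, hy₁, hinv,
      sub_add_cancel]
  have hfirst : ∀ q : ℂ[X], aeval (fromBlocks A G 0 D) q *ᵥ Sum.elim v₁ 0 =
      Sum.elim (aeval A q *ᵥ v₁) 0 := by
    intro q
    obtain ⟨Z, hZ⟩ := exists_aeval_fromBlocks A G D q
    rw [hZ, Matrix.fromBlocks_mulVec]
    simp
  refine ⟨Sum.elim y₁ v₂, fun q hq => ?_, ?_⟩
  -- The lower component forces `q = χ₂ r`; applying `χ₂` first leaves `r(A) v₁ = 0`, hence `χ₁ ∣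
  -- r`.
  · have h2 : χ₂ ∣ q := by
      refine hD₂ q ?_
      obtain ⟨Z, hZ⟩ := exists_aeval_fromBlocks A G D q
      rw [hZ, Matrix.fromBlocks_mulVec] at hq
      funext ix
      have := congrFun hq (Sum.inr ix)
      simpa using this
    obtain ⟨r, rfl⟩ := h2
    rw [mul_comm, map_mul, ← Matrix.mulVec_mulVec, hstep, hfirst] at hq
    rw [mul_comm χ₁]
    refine mul_dvd_mul_left _ (hA₁ r ?_)
    funext ix
    exact congrFun hq (Sum.inl ix)
  · rw [map_mul, ← Matrix.mulVec_mulVec, hstep, hfirst, hAχ]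
    funext ix
    cases ix <;> rfl

end Cyclic

/-! ### Similarity of the perturbed matrices to model operators. -/

/-- The eigenvalues of the perturbed operator, with multiplicity. -/
noncomputable def perturbedZeros (N : ℕ) (ν μ : (Fin (N + 1) → Fin 2) → ℝ) : Multiset ℂ :=
  (N + 1) • (univ.val.map fun x => (ν x : ℂ)) + (N + 1) • (univ.val.map fun x => (μ x : ℂ))

theorem exists_of_mem_perturbedZeros {N : ℕ} {ν μ : (Fin (N + 1) → Fin 2) → ℝ} {a : ℂ}
    (ha : a ∈ perturbedZeros N ν μ) : ∃ x, a = ν x ∨ a = μ x := by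
  rw [perturbedZeros, Multiset.mem_add] at ha
  rcases ha with h | h <;> obtain ⟨x, -, rfl⟩ := Multiset.mem_map.mp (Multiset.mem_of_mem_nsmul h)
  exacts [⟨x, Or.inl rfl⟩, ⟨x, Or.inr rfl⟩]

theorem similarOp_perturbed {N : ℕ} {α : ℕ → ℂ} {ν μ : (Fin (N + 1) → Fin 2) → ℝ}
    (hν : Function.Injective ν) (hμ : Function.Injective μ) (hνμ : ∀ x y, ν x ≠ μ y) {B : ℂ → ℂ}
    (hB : IsFiniteBlaschkeProduct B (perturbedZeros N ν μ)) :
    SimilarOp (toEuclideanCLM (n := FHIndex N) (𝕜 := ℂ)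
      (pisierMatrix N α + diagPerturbation N ν μ)) (modelOperator B) := by
  have hM : pisierMatrix N α + diagPerturbation N ν μ =
      fromBlocks ((truncShift (Fin (N + 1) → Fin 2) N)ᴴ + diagonal fun ix => (ν ix.2 : ℂ))
        (hankelMatrix N fun j => α j • carMatrix N j) 0
        (truncShift (Fin (N + 1) → Fin 2) N + diagonal fun ix => (μ ix.2 : ℂ)) := by
    rw [pisierMatrix, truncFoguelHankel, diagPerturbation, ← Matrix.fromBlocks_diagonal,
      Matrix.fromBlocks_add, add_zero, add_zero]
  obtain ⟨v, hv, hv'⟩ := exists_cyclic_vector (N := N) (ν := fun x => (ν x : ℂ))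
    (μ := fun x => (μ x : ℂ)) (Complex.ofReal_injective.comp hν) (Complex.ofReal_injective.comp hμ)
    (fun x y h => hνμ x y (Complex.ofReal_injective h))
    (hankelMatrix N fun j => α j • carMatrix N j)
  rw [← hM] at hv hv'
  have hχ : ((perturbedZeros N ν μ).map fun a => X - C a).prod =
      (∏ x, (X - C (ν x : ℂ))) ^ (N + 1) * (∏ x, (X - C (μ x : ℂ))) ^ (N + 1) := by
    rw [perturbedZeros, Multiset.map_add, Multiset.prod_add, Multiset.map_nsmul,
      Multiset.map_nsmul, Multiset.prod_nsmul, Multiset.prod_nsmul, Multiset.map_map,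
      Multiset.map_map]
    rfl
  have happ : ∀ q : ℂ[X], aeval (toEuclideanCLM (n := FHIndex N) (𝕜 := ℂ)
      (pisierMatrix N α + diagPerturbation N ν μ)) q (WithLp.toLp 2 v) =
      WithLp.toLp 2 (aeval (pisierMatrix N α + diagPerturbation N ν μ) q *ᵥ v) := by
    intro q
    have e : aeval (toEuclideanCLM (n := FHIndex N) (𝕜 := ℂ)
        (pisierMatrix N α + diagPerturbation N ν μ)) q = toEuclideanCLM (n := FHIndex N) (𝕜 := ℂ)
        (aeval (pisierMatrix N α + diagPerturbation N ν μ) q) :=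
      aeval_algHom_apply (toEuclideanCLM (n := FHIndex N) (𝕜 := ℂ)).toAlgEquiv.toAlgHom _ _
    rw [e, toEuclideanCLM_toLp]
  refine similarOp_modelOperator hB ?_ (v := WithLp.toLp 2 v) (fun q hq => ?_) ?_
  · rw [finrank_euclideanSpace, perturbedZeros]
    simp
  · rw [hχ]
    refine hv q ?_
    rw [happ] at hq
    simpa using hq
  · rw [hχ, happ, hv']
    rfl

open scoped Matrix.Norms.L2Operator in
theorem norm_toEuclideanCLM_diagPerturbation_lt {N : ℕ} {ν μ : (Fin (N + 1) → Fin 2) → ℝ} {δ : ℝ}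
    (hδ : 0 < δ) (hν : ∀ x, ν x ∈ Set.Ioo 0 δ) (hμ : ∀ x, μ x ∈ Set.Ioo 0 δ) :
    ‖toEuclideanCLM (n := FHIndex N) (𝕜 := ℂ) (diagPerturbation N ν μ)‖ < δ := by
  rw [Matrix.l2_opNorm_toEuclideanCLM, diagPerturbation, Matrix.l2_opNorm_diagonal,
    pi_norm_lt_iff hδ]
  rintro (x | x)
  · simpa [abs_of_pos (hν x.2).1] using (hν x.2).2
  · simpa [abs_of_pos (hμ x.2).1] using (hμ x.2).2

/-! ### The coefficients -/

/-- Coefficients with `|α_j|² = (j + 1)⁻² - (j + 2)⁻²`. -/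
noncomputable def foguelCoeff (j : ℕ) : ℂ :=
  (√(1 / ((j : ℝ) + 1) ^ 2 - 1 / ((j : ℝ) + 2) ^ 2) : ℝ)

theorem norm_foguelCoeff_sq (j : ℕ) :
    ‖foguelCoeff j‖ ^ 2 = 1 / ((j : ℝ) + 1) ^ 2 - 1 / ((j : ℝ) + 2) ^ 2 := by
  rw [foguelCoeff, Complex.norm_real, Real.norm_eq_abs, sq_abs, Real.sq_sqrt]
  rw [sub_nonneg]
  gcongr
  norm_num

theorem foguelCoeff_tail (N m : ℕ) (hm : m ≤ N) :
    ((m : ℝ) + 1) ^ 2 * ∑ j ∈ Icc m N, ‖foguelCoeff j‖ ^ 2 ≤ 1 := by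
  have h : ∑ j ∈ Icc m N, ‖foguelCoeff j‖ ^ 2 =
      1 / ((m : ℝ) + 1) ^ 2 - 1 / ((N : ℝ) + 2) ^ 2 := by
    induction N, hm using Nat.le_induction with
    | base => rw [Icc_self, sum_singleton, norm_foguelCoeff_sq]
    | succ N hN ih =>
      rw [← Finset.insert_Icc_right_eq_Icc_add_one (by omega), Finset.sum_insert (by simp), ih,
        norm_foguelCoeff_sq]
      push_cast
      ring
  rw [h, mul_sub, mul_one_div_cancel (by positivity)]
  have : 0 ≤ ((m : ℝ) + 1) ^ 2 * (1 / ((N : ℝ) + 2) ^ 2) := by positivity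
  linarith

/-- The right side equals `(2j + 3) / (j + 2)²`; comparison with the harmonic series makes the sums
diverge. -/
theorem inv_le_sq_mul_norm_foguelCoeff_sq (j : ℕ) :
    1 / ((j : ℝ) + 1 + 1) ≤ ((j : ℝ) + 1) ^ 2 * ‖foguelCoeff j‖ ^ 2 := by
  rw [norm_foguelCoeff_sq, mul_sub, mul_one_div_cancel (by positivity), mul_one_div,
    le_sub_iff_add_le, div_add_div _ _ (by positivity) (by positivity), div_le_one (by positivity)]
  have hj : (0 : ℝ) ≤ j := j.cast_nonneg
  nlinarith [mul_nonneg hj hj]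

theorem tendsto_sum_foguelCoeff : Filter.Tendsto
    (fun N => ∑ j ∈ range (N + 1), ((j : ℝ) + 1) ^ 2 * ‖foguelCoeff j‖ ^ 2)
    Filter.atTop Filter.atTop := by
  -- The comparison starts at `1/2`, so the harmonic sum is taken with `N + 2` terms and its first
  -- term `1` is subtracted.
  have h := Real.tendsto_sum_range_one_div_nat_succ_atTop.comp (Filter.tendsto_add_atTop_nat 2)
  have h2 := Filter.tendsto_atTop_add_const_right _ (-1 : ℝ) h
  refine Filter.tendsto_atTop_mono (fun N => ?_) h2
  simp only [Function.comp_apply]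
  rw [Finset.sum_range_succ']
  have : ∑ j ∈ range (N + 1), 1 / (((j + 1 : ℕ) : ℝ) + 1) ≤
      ∑ j ∈ range (N + 1), ((j : ℝ) + 1) ^ 2 * ‖foguelCoeff j‖ ^ 2 :=
    Finset.sum_le_sum fun j _ => by
      push_cast
      exact inv_le_sq_mul_norm_foguelCoeff_sq j
  simp only [CharP.cast_eq_zero, zero_add, div_one]
  linarith

theorem admissibleCoeffs_foguelCoeff : AdmissibleCoeffs fun _ => foguelCoeff := by
  refine ⟨⟨1, fun N n hn => ?_⟩, fun K => ?_⟩
  · rw [Finset.mem_Icc] at hn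
    obtain ⟨m, rfl⟩ := Nat.exists_eq_add_of_le' hn.1
    have := foguelCoeff_tail N m (by omega)
    simpa using this
  · obtain ⟨N, hN⟩ := (tendsto_sum_foguelCoeff.eventually_gt_atTop K).exists
    refine ⟨N, hN.trans_eq ?_⟩
    rw [show Icc 1 (N + 1) = Ico 1 (N + 2) by ext; simp; omega, Finset.sum_Ico_eq_sum_range]
    refine Finset.sum_congr rfl fun j _ => ?_
    rw [Nat.add_sub_cancel_left]
    push_cast
    ring

/-- Small perturbations with all the required properties at level `N`. -/
theorem exists_perturbation (N : ℕ) {ε : ℝ} (hε : 0 < ε) :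
    ∃ ν μ : (Fin (N + 1) → Fin 2) → ℝ,
      (∀ x, ν x ∈ Set.Ioo 0 ε ∧ μ x ∈ Set.Ioo 0 ε) ∧
      (∀ x, ν x < 1 ∧ μ x < 1) ∧
      Function.Injective ν ∧ Function.Injective μ ∧ (∀ x y, ν x ≠ μ y) ∧
      Mpb (toEuclideanCLM (n := FHIndex N) (𝕜 := ℂ)
        (pisierMatrix N foguelCoeff + diagPerturbation N ν μ)) ≤ ENNReal.ofReal 4 ∧
      ENNReal.ofReal (√(∑ j ∈ range (N + 1), ((j : ℝ) + 1) ^ 2 * ‖foguelCoeff j‖ ^ 2) / 4) ≤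
        Mcpb (toEuclideanCLM (n := FHIndex N) (𝕜 := ℂ)
          (pisierMatrix N foguelCoeff + diagPerturbation N ν μ)) := by
  have hpos : 0 < ∑ j ∈ range (N + 1), ((j : ℝ) + 1) ^ 2 * ‖foguelCoeff j‖ ^ 2 :=
    Finset.sum_pos (fun j _ => lt_of_lt_of_le (by positivity) (inv_le_sq_mul_norm_foguelCoeff_sq j))
      (by simp)
  obtain ⟨δ, hδ, h⟩ := Metric.eventually_nhds_iff.mp
    ((eventually_Mpb_le (foguelCoeff_tail N)).and (eventually_le_Mcpb foguelCoeff hpos))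
  -- The three bounds keep the entries below `ε`, the zeros inside the disk, and the operator in the
  -- neighbourhood where both estimates hold.
  set r := min (min ε 1) δ with hr
  have hr0 : 0 < r := by positivity
  let κ := Fin (N + 1) → Fin 2
  -- One injective function on the disjoint union makes `ν` and `μ` injective with disjoint ranges;
  -- the `+ 2` keeps every value strictly below `r`.
  let f : κ ⊕ κ → ℝ := fun x => r / (Encodable.encode x + 2)
  have hf : Function.Injective f := by
    intro x y hxy
    have h1 : ((Encodable.encode x : ℝ) + 2) = Encodable.encode y + 2 := by
      have h2 : r / ((Encodable.encode x : ℝ) + 2) = r / (Encodable.encode y + 2) := hxy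
      rw [div_eq_div_iff (by positivity) (by positivity)] at h2
      exact (mul_left_cancel₀ hr0.ne' h2).symm
    exact Encodable.encode_injective (by exact_mod_cast add_right_cancel h1)
  have hfr : ∀ x, f x ∈ Set.Ioo 0 r := by
    intro x
    refine ⟨by positivity, ?_⟩
    rw [div_lt_iff₀ (by positivity)]
    nlinarith [(Nat.cast_nonneg (Encodable.encode x) : (0 : ℝ) ≤ _)]
  have hε' : r ≤ ε := (min_le_left _ _).trans (min_le_left _ _)
  have h1' : r ≤ 1 := (min_le_left _ _).trans (min_le_right _ _)
  have hlt : ∀ {c : ℝ}, r ≤ c → ∀ x, f x ∈ Set.Ioo 0 c := fun hc x =>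
    ⟨(hfr x).1, (hfr x).2.trans_le hc⟩
  have hT := h (y := toEuclideanCLM (n := FHIndex N) (𝕜 := ℂ) (pisierMatrix N foguelCoeff +
      diagPerturbation N (fun x => f (Sum.inl x)) (fun x => f (Sum.inr x)))) (by
    rw [dist_eq_norm, map_add, add_sub_cancel_left]
    exact norm_toEuclideanCLM_diagPerturbation_lt hδ (fun x => hlt (min_le_right _ _) _)
      (fun x => hlt (min_le_right _ _) _))
  exact ⟨fun x => f (Sum.inl x), fun x => f (Sum.inr x), fun x => ⟨hlt hε' _, hlt hε' _⟩,
    fun x => ⟨(hlt h1' _).2, (hlt h1' _).2⟩, hf.comp Sum.inl_injective, hf.comp Sum.inr_injective,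
    fun x y hxy => Sum.inl_ne_inr (hf hxy), hT.1, hT.2⟩

end

/-! ### The main theorem. -/

theorem theorem6p3 :
    ∃ α : ℕ → ℕ → ℂ, AdmissibleCoeffs α ∧
      ∀ ε : ℕ → ℝ, (∀ N, 0 < ε N) →
        ∃ (ν μ : ∀ N : ℕ, (Fin (N + 1) → Fin 2) → ℝ)
          (T : ∀ N : ℕ, EuclideanSpace ℂ (FHIndex N) →L[ℂ] EuclideanSpace ℂ (FHIndex N))
          (B : ℕ → ℂ → ℂ) (Z : ℕ → Multiset ℂ),
          (∀ N l, ν N l ∈ Set.Ioo 0 (ε N) ∧ μ N l ∈ Set.Ioo 0 (ε N)) ∧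
          (∀ N, T N = Matrix.toEuclideanCLM (n := FHIndex N) (𝕜 := ℂ)
            (pisierMatrix N (α N) + diagPerturbation N (ν N) (μ N))) ∧
          (∀ N, IsFiniteBlaschkeProduct (B N) (Z N)) ∧
          (∀ N, ∀ a ∈ Z N, ∃ r ∈ Set.Ioo (0 : ℝ) 1, a = (r : ℂ)) ∧
          (∀ N, SimilarOp (T N) (modelOperator (B N))) ∧
          (⨆ N, Mpb (T N)) < ⊤ ∧
          (⨆ N, Mcpb (T N)) = ⊤ := by
  refine ⟨fun _ => foguelCoeff, admissibleCoeffs_foguelCoeff, fun ε hε => ?_⟩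
  choose ν μ hmem hone hν hμ hνμ hpb hcpb using fun N => exists_perturbation N (hε N)
  have hZ : ∀ N, ∀ a ∈ perturbedZeros N (ν N) (μ N), ∃ r ∈ Set.Ioo (0 : ℝ) 1, a = (r : ℂ) := by
    intro N a ha
    obtain ⟨x, rfl | rfl⟩ := exists_of_mem_perturbedZeros ha
    · exact ⟨_, ⟨(hmem N x).1.1, (hone N x).1⟩, rfl⟩
    · exact ⟨_, ⟨(hmem N x).2.1, (hone N x).2⟩, rfl⟩
  have hB : ∀ N, IsFiniteBlaschkeProduct
      (fun z => ((perturbedZeros N (ν N) (μ N)).map fun a => blaschkeFactor a z).prod)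
      (perturbedZeros N (ν N) (μ N)) := by
    refine fun N => ⟨fun a ha => ?_, 1, norm_one, fun z _ => (one_mul _).symm⟩
    obtain ⟨r, hr, rfl⟩ := hZ N a ha
    rw [Complex.norm_real, Real.norm_eq_abs, abs_of_pos hr.1]
    exact hr.2
  refine ⟨ν, μ, _, _, fun N => perturbedZeros N (ν N) (μ N), hmem, fun N => rfl, hB, hZ,
    fun N => similarOp_perturbed (hν N) (hμ N) (hνμ N) (hB N), ?_, ?_⟩
  · exact lt_of_le_of_lt (iSup_le hpb) ENNReal.ofReal_lt_top
  · refine eq_top_mono (iSup_mono hcpb) ?_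
    rw [iSup_eq_top]
    intro b hb
    have hlim : Filter.Tendsto (fun N : ℕ => √(∑ j ∈ Finset.range (N + 1),
        ((j : ℝ) + 1) ^ 2 * ‖foguelCoeff j‖ ^ 2) / 4) Filter.atTop Filter.atTop :=
      (Real.tendsto_sqrt_atTop.comp tendsto_sum_foguelCoeff).atTop_div_const (by norm_num)
    obtain ⟨N, hN⟩ := (hlim.eventually_gt_atTop b.toReal).exists
    exact ⟨N, (ENNReal.lt_ofReal_iff_toReal_lt hb.ne).mpr hN⟩
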